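/- All graphs are finite and may have loops and multiple edges; a loop adds $2$ to the degree of its vertex, and an independent set induces no edge and no loop. An $\ell$-factor is an $\ell$-regular spanning subgraph. Let $G$ be a $(2r+1)$-regular graph and let $R,S,T$ be a partition of $V(G)$ (empty parts allowed). A component $Q$ of $G[R]$ is called a *blister* if exactly one edge joins $S$ to $Q$, exactly one edge joins $T$ to $Q$, with ends $u$ and $v$ in $Q$ respectively, and $Q=H-e'$ for some $(2r+1)$-regular graph $H$ without cut-edges and some edge $e'$ of $H$ joining $u$ and $v$ (a loop if $u=v$). **Theorem.** Let $r,k\ge 0$ be integers with $k\le (2r+1)/3$, and let $G$ be a $(2r+1)$-regular graph with exactly $2r+4-3k$ cut-edges. Then $G$ has no $2k$-factor if and only if $V(G)$ has a partition into sets $R,S,T$ such that (a) $S$ and $T$ are independent and $|T|>|S|$; (b) every cut-edge of $G$ joins $T$ to a component of $G[R]$, distinct cut-edges leading to distinct components; (c) every edge incident to $S$ has its other end in $T$ or in a component of $G[R]$ that is a blister; (d) exactly $k(|T|-|S|)-1$ components of $G[R]$ are joined to $T$ by exactly three edges; (e) every remaining component of $G[R]$, that is, every component that is not joined to $T$ by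 a cut-edge, is not a blister, and is not joined to $T$ by exactly three edges, is itself a $(2r+1)$-regular graph with no cut-edge; (f) if $k<(2r+1)/3$, then $|T|-|S|=1$. -/

import Mathlib

/-! Multigraphs, with loops and multiple edges allowed, are Mathlib's `Graph α β`. -/

namespace Graph

variable {α β : Type*}

/-- The degree of a vertex of a multigraph: each loop counts twice. -/
noncomputable def degree (G : Graph α β) (v : α) : ℕ :=
  {e | G.IsNonloopAt e v}.ncard + 2 * (G.loopSet v).ncard

/-- Every vertex has degree `d`. -/
def IsRegular (G : Graph α β) (d : ℕ) : Prop :=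
  ∀ v ∈ G.vertexSet, G.degree v = d

/-- A `d`-factor is a `d`-regular spanning subgraph. -/
def HasFactor (G : Graph α β) (d : ℕ) : Prop :=
  ∃ F : Graph α β, F.IsSpanningSubgraph G ∧ F.IsRegular d

/-- There is a walk from `x` to `y`. -/
def Reachable (G : Graph α β) (x y : α) : Prop :=
  Relation.ReflTransGen G.Adj x y

/-- A cut-edge: an edge whose ends lie in different components once it is deleted. -/
def IsCutEdge (G : Graph α β) (e : β) : Prop :=
  ∃ x y, G.IsLink e x y ∧ ¬ (G.deleteEdges {e}).Reachable x y

/-- `Q` is the vertex set of a component of `G`. -/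
def IsComponent (G : Graph α β) (Q : Set α) : Prop :=
  ∃ x ∈ G.vertexSet, Q = {y | G.Reachable x y}

/-- No edge (in particular no loop) has both ends in `X`. -/
def IsIndependent (G : Graph α β) (X : Set α) : Prop :=
  ∀ x ∈ X, ∀ y ∈ X, ¬ G.Adj x y

/-- The set of edges with one end in `A` and the other in `B`. -/
def edgesBetween (G : Graph α β) (A B : Set α) : Set β :=
  {e | ∃ x ∈ A, ∃ y ∈ B, G.IsLink e x y}

/-- `Q` (meant to be a component of what is left of `G` without `S` and `T`) is a blister on an
edge from `S` to `T` of a `d`-regular graph: it is joined to `S` by a single edge `e₁ = s u` and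
to `T` by a single edge `e₂ = t v`, and the subgraph of `G` on `Q` is `H - e'`, where `H` is a
`d`-regular graph without cut-edges and `e' = u v` is an edge of `H`. Replacing `Q`, `e₁`, `e₂` by
one edge `s t` undoes the blistering. (The edge `e'` may be a loop;
for `d = 1` or `d = 3` that is excluded automatically, since a loop at a vertex of degree `3` is
attached to the rest of its graph by a cut-edge.) -/
def IsBlister (G : Graph α β) (d : ℕ) (S T Q : Set α) : Prop :=
  ∃ (e₁ e₂ : β) (s t u v : α),
    G.edgesBetween S Q = {e₁} ∧ s ∈ S ∧ u ∈ Q ∧ G.IsLink e₁ s u ∧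
    G.edgesBetween T Q = {e₂} ∧ t ∈ T ∧ v ∈ Q ∧ G.IsLink e₂ t v ∧
    ∃ (H : Graph α β) (e' : β), H.IsRegular d ∧ (∀ e, ¬ H.IsCutEdge e) ∧
      H.IsLink e' u v ∧ H.deleteEdges {e'} = G.induce Q

end Graph

/-! ### Barriers, from Tutte's theorem -/

/-! Write d = 2r+1 and t = |T| - |S|; for a component Q of G[R] let a(Q) and b(Q) be the numbers of
edges joining Q to T and to S.

Without a 2k-factor, Tutte's f-factor theorem (`hasFactor_or_barrier`) yields a partition with 2e(T)
+ Σ a(Q) < 2kt + #{Q : a(Q) odd}, that is, e(T) + Σ ⌊a(Q)/2⌋ ≤ kt - 1; in particular t ≥ 1. Counting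
degrees in T and in S gives dt = 2e(T) - 2e(S) + Σ (a(Q) - b(Q)). Always a - b ≤ 3⌊a/2⌋ + [a = 1, b
= 0], and a component with a = 1, b = 0 hangs on a cut-edge of its own, so there are at most d + 3 -
3k of these. Together, (d - 3k)(t - 1) + e(T) + 2e(S) ≤ 0. Every term is nonnegative, so every
estimate used is an equality (`barrier_equalities`): S and T are independent, (a, b) is one of
(1,0), (1,1), (3,0), (0,0), the components with a = 3 number kt - 1, t = 1 unless d = 3k, and all
cut-edges of G join T to the (1,0) components. As no other cut-edges exist, (1,1) components are
blisters (`IsPartition.isBlister`) and (0,0) components are regular without cut-edges.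

Conversely (`IsPartition.not_hasFactor`), a 2k-factor avoids cut-edges and sends an even number of
edges into each Q. Its degree sum, 2kt, is then too large for what the components can absorb.

The f-factor theorem itself comes from Tutte's perfect matching theorem applied to a gadget, with a
barrier chosen so that each of its vertices sees at least three classes outside it. -/

open Finset in
/-- `X` is a barrier of `H`, witnessed by a labelling `c` that is constant on the components of
`H - X` and has more than `#X` odd classes. -/
def SimpleGraph.IsBarrier {W ι : Type*} [Fintype W] [DecidableEq W] [Fintype ι] [DecidableEq ι]
    (H : SimpleGraph W) (X : Finset W) (c : W → ι) : Prop :=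
  (∀ u v, H.Adj u v → u ∉ X → v ∉ X → c u = c v) ∧
    #X < #{i | Odd #{v | v ∉ X ∧ c v = i}}

namespace SimpleGraph

open Finset

variable {W ι : Type*} [Fintype W] [DecidableEq W] [Fintype ι] [DecidableEq ι]

theorem exists_isPerfectMatching_or_isBarrier [DecidableEq (Set W)] (H : SimpleGraph W) :
    (∃ M : H.Subgraph, M.IsPerfectMatching) ∨
      ∃ (X : Finset W) (c : W → Set W), H.IsBarrier X c := by
  classical
  by_cases hM : ∃ M : H.Subgraph, M.IsPerfectMatching
  · exact .inl hM
  right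
  rw [SimpleGraph.tutte] at hM
  push Not at hM
  obtain ⟨u, hu⟩ := hM
  set K := ((⊤ : H.Subgraph).deleteVerts u).coe with hK
  have hmem : ∀ v, v ∈ ((⊤ : H.Subgraph).deleteVerts u).verts ↔ v ∉ u := by simp
  refine ⟨u.toFinset, fun v ↦ if h : v ∈ ((⊤ : H.Subgraph).deleteVerts u).verts then
    Subtype.val '' (K.connectedComponentMk ⟨v, h⟩).supp else ∅, ?_, ?_⟩
  · intro a b hab ha hb
    rw [Set.mem_toFinset] at ha hb
    beta_reduce
    rw [dif_pos ((hmem a).2 ha), dif_pos ((hmem b).2 hb)]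
    have : K.Adj ⟨a, (hmem a).2 ha⟩ ⟨b, (hmem b).2 hb⟩ := by
      simp [hK, ha, hb, hab]
    rw [ConnectedComponent.connectedComponentMk_eq_of_adj this]
  · have h1 : #u.toFinset = u.ncard := (Set.ncard_eq_toFinset_card' u).symm
    rw [h1]
    refine lt_of_lt_of_le hu ?_
    rw [← Set.ncard_coe_finset]
    refine Set.ncard_le_ncard_of_injOn (fun C ↦ Subtype.val '' C.supp) ?_ ?_ (Set.toFinite _)
    · intro C hC
      simp only [coe_filter, mem_univ, true_and, Set.mem_ofPred_eq]
      have : ({v | v ∉ u.toFinset ∧ (if h : v ∈ ((⊤ : H.Subgraph).deleteVerts u).verts then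
          Subtype.val '' (K.connectedComponentMk ⟨v, h⟩).supp else ∅) =
          Subtype.val '' C.supp} : Finset W) = (Subtype.val '' C.supp).toFinset := by
        ext v
        simp only [mem_filter, mem_univ, true_and, Set.mem_toFinset]
        constructor
        · rintro ⟨hv, h⟩
          rw [dif_pos ((hmem v).2 hv)] at h
          rw [← h]
          exact ⟨_, rfl, rfl⟩
        · rintro ⟨w, hw, rfl⟩
          have hw' := (hmem w.1).1 w.2
          refine ⟨hw', ?_⟩
          rw [dif_pos w.2]
          rw [ConnectedComponent.mem_supp_iff] at hw
          rw [← hw]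
      rw [this, ← Set.ncard_eq_toFinset_card', Set.ncard_image_of_injective _
        Subtype.val_injective]
      exact hC
    · intro C _ C' _ h
      exact ConnectedComponent.supp_injective (Set.image_injective.2 Subtype.val_injective h)

/-- A vertex whose neighbours outside the barrier meet at most two classes is superfluous. -/
theorem IsBarrier.erase {H : SimpleGraph W} {X : Finset W} {c : W → ι} (hX : H.IsBarrier X c)
    {h : W} (hh : h ∈ X) (i j : ι) (hij : ∀ u, H.Adj h u → u ∉ X → c u = i ∨ c u = j) :
    ∃ c' : W → ι, H.IsBarrier (X.erase h) c' := by
  classical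
  obtain ⟨hc, hcard⟩ := hX
  -- The vertex `h` and the class `j` are absorbed into the class `i`. For `i ≠ j` the new size is
  -- `n i + n j + 1`, odd when both old classes were odd; in every case at most one odd class is
  -- lost, which the loss of `h` from the barrier pays for.
  refine ⟨fun v ↦ if v = h ∨ c v = j then i else c v, ?_, ?_⟩
  · intro u v huv hu hv
    simp only [mem_erase, not_and_or, not_not] at hu hv
    by_cases hu' : u = h
    · subst hu'
      have hv' : v ∉ X := hv.resolve_left huv.ne'
      rcases hij v huv hv' with h1 | h1 <;> simp [h1]
    by_cases hv' : v = h
    · subst hv'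
      have hu' : u ∉ X := hu.resolve_left huv.ne
      rcases hij u huv.symm hu' with h1 | h1 <;> simp [h1]
    · simp [hu', hv', hc u v huv (hu.resolve_left hu') (hv.resolve_left hv')]
  · set c' : W → ι := fun v ↦ if v = h ∨ c v = j then i else c v with hc'
    set n : ι → ℕ := fun m ↦ #{v | v ∉ X ∧ c v = m} with hn
    set n' : ι → ℕ := fun m ↦ #{v | v ∉ X.erase h ∧ c' v = m} with hn'
    have hother : ∀ m, m ≠ i → m ≠ j → n' m = n m := by
      intro m hmi hmj
      simp only [hn, hn']
      congr 1
      ext v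
      simp only [mem_filter, mem_univ, true_and, mem_erase, hc']
      by_cases hv : v = h
      · subst hv; simp [hh, hmi.symm]
      · by_cases hvj : c v = j
        · simp [hvj, hmi.symm, hmj.symm]
        · simp [hv, hvj]
    have hi : n' i = n i + (if i = j then 0 else n j) + 1 := by
      have : ({v | v ∉ X.erase h ∧ c' v = i} : Finset W) =
          insert h ({v | v ∉ X ∧ (c v = i ∨ c v = j)} : Finset W) := by
        ext v
        simp only [mem_filter, mem_univ, true_and, mem_erase, hc', mem_insert]
        by_cases hv : v = h
        · subst hv; simp
        · by_cases hvj : c v = j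
          · simp [hvj, hv]
          · simp [hv, hvj]
      simp only [hn, hn']
      rw [this, card_insert_of_notMem (by simp [hh])]
      split_ifs with hij'
      · simp [hij']
      · rw [← card_union_of_disjoint]
        · congr 2
          ext v
          simp only [mem_filter, mem_univ, true_and, mem_union]
          tauto
        · rw [Finset.disjoint_left]
          intro v hv hv'
          simp only [mem_filter, mem_univ, true_and] at hv hv'
          exact hij' (hv.2.symm.trans hv'.2)
    rw [card_erase_of_mem hh]
    have hXpos : 0 < #X := card_pos.2 ⟨h, hh⟩
    suffices #{m | Odd (n m)} ≤ #{m | Odd (n' m)} + 1 by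
      have : #X < #{m | Odd (n m)} := hcard
      change #X - 1 < #{m | Odd (n' m)}
      omega
    have hsplit : ∀ f : ι → ℕ, #{m | Odd (f m)} =
        #{m | (m ≠ i ∧ m ≠ j) ∧ Odd (f m)} + #{m | (m = i ∨ m = j) ∧ Odd (f m)} := by
      intro f
      rw [← card_union_of_disjoint]
      · congr 1
        ext m
        simp only [mem_filter, mem_univ, true_and, mem_union]
        tauto
      · rw [Finset.disjoint_left]
        intro v hv hv'
        simp only [mem_filter, mem_univ, true_and] at hv hv'
        tauto
    rw [hsplit n, hsplit n']
    have h1 : ({m | (m ≠ i ∧ m ≠ j) ∧ Odd (n m)} : Finset ι) =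
        ({m | (m ≠ i ∧ m ≠ j) ∧ Odd (n' m)} : Finset ι) := by
      ext m
      simp only [mem_filter, mem_univ, true_and]
      refine and_congr_right fun hm ↦ ?_
      rw [hother m hm.1 hm.2]
    rw [h1]
    have h2 : #{m | (m = i ∨ m = j) ∧ Odd (n m)} ≤
        #{m | (m = i ∨ m = j) ∧ Odd (n' m)} + 1 := by
      by_cases hij' : i = j
      · subst hij'
        calc _ ≤ #{i} := card_le_card (by intro m; simp +contextual)
          _ ≤ _ := by simp
      · have hle : #{m | (m = i ∨ m = j) ∧ Odd (n m)} ≤ 2 :=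
          calc _ ≤ #{i, j} := card_le_card (by intro m; simp +contextual)
            _ ≤ 2 := card_le_two
        by_cases hodd : Odd (n' i)
        · have : 0 < #{m | (m = i ∨ m = j) ∧ Odd (n' m)} :=
            card_pos.2 ⟨i, by simp [hodd]⟩
          omega
        · have hd : ¬ (Odd (n i) ∧ Odd (n j)) := by
            rintro ⟨ho, ho'⟩
            rw [hi, if_neg hij'] at hodd
            exact hodd ((ho.add_odd ho').add_one)
          have : #{m | (m = i ∨ m = j) ∧ Odd (n m)} ≤ 1 := by
            rw [card_le_one]
            intro a ha b hb
            simp only [mem_filter, mem_univ, true_and] at ha hb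
            rcases ha with ⟨rfl | rfl, ha⟩ <;> rcases hb with ⟨rfl | rfl, hb⟩ <;> tauto
          omega
    omega

/-- From any barrier one can pass to a minimal one. -/
theorem IsBarrier.exists_minimal {H : SimpleGraph W} {X : Finset W} {c : W → ι}
    (hX : H.IsBarrier X c) : ∃ (Y : Finset W) (c' : W → ι), H.IsBarrier Y c' ∧
      ∀ h ∈ Y, ∀ i j, ∃ u, H.Adj h u ∧ u ∉ Y ∧ c' u ≠ i ∧ c' u ≠ j := by
  induction hn : #X generalizing X c with
  | zero =>
    refine ⟨X, c, hX, fun h hh ↦ ?_⟩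
    rw [card_eq_zero.1 hn] at hh
    simp at hh
  | succ n ih =>
    by_cases h : ∃ h ∈ X, ∃ i j, ∀ u, H.Adj h u → u ∉ X → c u = i ∨ c u = j
    · obtain ⟨h, hh, i, j, hij⟩ := h
      obtain ⟨c', hc'⟩ := hX.erase hh i j hij
      exact ih hc' (by rw [card_erase_of_mem hh, hn]; rfl)
    · push Not at h
      exact ⟨X, c, hX, h⟩

end SimpleGraph

/-! ### The factor theorem

A multigraph is given by a map `p : E × Bool → V` sending each half-edge to its vertex. -/

namespace HalfEdge

open Finset

/-- The other half of the same edge. -/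
def opp {E : Type*} (h : E × Bool) : E × Bool := (h.1, !h.2)

@[simp] theorem opp_opp {E : Type*} (h : E × Bool) : opp (opp h) = h := by simp [opp]

theorem opp_ne {E : Type*} (h : E × Bool) : opp h ≠ h := by
  intro hh
  simpa [opp] using congrArg Prod.snd hh

theorem opp_injective {E : Type*} : Function.Injective (opp (E := E)) :=
  Function.LeftInverse.injective opp_opp

theorem even_card_of_opp_mem {E : Type*} (s : Finset (E × Bool)) (hs : ∀ h ∈ s, opp h ∈ s) :
    Even #s := by
  classical
  rw [← card_filter_add_card_filter_not (s := s) (fun h ↦ h.2 = true)]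
  have : #{h ∈ s | h.2 = true} = #{h ∈ s | ¬ h.2 = true} := by
    refine card_nbij' opp opp ?_ ?_ (fun _ _ ↦ opp_opp _) (fun _ _ ↦ opp_opp _)
    · intro h hh
      simp only [coe_filter, Set.mem_ofPred_eq] at hh ⊢
      exact ⟨hs h hh.1, by simp [opp, hh.2]⟩
    · intro h hh
      simp only [coe_filter, Set.mem_ofPred_eq] at hh ⊢
      exact ⟨hs h hh.1, by simpa [opp] using hh.2⟩
  rw [this]
  exact ⟨_, rfl⟩

universe u w

variable {V : Type u} {E : Type w} [Fintype E] [DecidableEq V] [DecidableEq E]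

/-- Tutte's gadget: the half-edges, and `deg v - f v` further vertices for each `v`, all of them
joined to the half-edges at `v`. -/
def gadget (p : E × Bool → V) (f : V → ℕ) :
    SimpleGraph ((E × Bool) ⊕ (Σ v, Fin (#{h | p h = v} - f v))) where
  Adj
    | .inl h, .inl h' => h' = opp h
    | .inl h, .inr b => p h = b.1
    | .inr b, .inl h => p h = b.1
    | .inr _, .inr _ => False
  symm := ⟨by
    rintro (h | b) (h' | b') hh
    · change h = opp h'
      rw [show h' = opp h from hh, opp_opp]
    · exact hh
    · exact hh
    · exact hh⟩
  loopless := ⟨by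
    rintro (h | b) hh
    · exact opp_ne h (Eq.symm hh)
    · exact hh⟩

/-- Take the edges whose two halves are matched to each other. The remaining half-edges at `v` are
matched with the `deg v - f v` extra vertices of `v`, each of which is used exactly once, so `f v`
half-edges are left for the factor. -/
theorem exists_factor_of_isPerfectMatching (p : E × Bool → V) (f : V → ℕ)
    (hf : ∀ v, f v ≤ #{h | p h = v}) {M : (gadget p f).Subgraph} (hM : M.IsPerfectMatching) :
    ∃ F : Finset E, ∀ v, #{h : E × Bool | h.1 ∈ F ∧ p h = v} = f v := by
  classical
  rw [SimpleGraph.Subgraph.isPerfectMatching_iff] at hM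
  set F : Finset E := {e | M.Adj (.inl (e, true)) (.inl (e, false))} with hF
  refine ⟨F, fun v ↦ ?_⟩
  have hFmem : ∀ h : E × Bool, h.1 ∈ F ↔ M.Adj (.inl h) (.inl (opp h)) := by
    rintro ⟨e, _ | _⟩
    · simp [hF, opp, M.adj_comm]
    · simp [hF, opp]
  have hex : ∀ b : Fin (#{h | p h = v} - f v), ∃ h, M.Adj (.inr ⟨v, b⟩) (.inl h) := by
    intro b
    obtain ⟨w, hw, -⟩ := hM (.inr ⟨v, b⟩)
    rcases w with h | b'
    · exact ⟨h, hw⟩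
    · exact (M.adj_sub hw).elim
  choose g hg using hex
  have hinj : Function.Injective g := by
    intro b b' hbb
    have h1 := (hg b).symm
    have h2 := (hg b').symm
    rw [← hbb] at h2
    have := (hM _).unique h1 h2
    simpa using this
  have himg : ({h | ¬ h.1 ∈ F ∧ p h = v} : Finset (E × Bool)) = univ.image g := by
    ext h
    simp only [mem_filter, mem_univ, true_and, mem_image]
    constructor
    · rintro ⟨hh, hv⟩
      rw [hFmem] at hh
      obtain ⟨w, hw, -⟩ := hM (.inl h)
      rcases w with h' | ⟨v', b⟩
      · have : h' = opp h := M.adj_sub hw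
        rw [this] at hw
        exact (hh hw).elim
      · have h1 : p h = v' := M.adj_sub hw
        obtain rfl : v' = v := h1.symm.trans hv
        refine ⟨b, ?_⟩
        have := (hM _).unique (hg b) hw.symm
        simpa using this
    · rintro ⟨b, rfl⟩
      refine ⟨?_, M.adj_sub (hg b)⟩
      rw [hFmem]
      intro h1
      have := (hM _).unique (hg b).symm h1
      simp at this
  have hcard : #({h | ¬ h.1 ∈ F ∧ p h = v} : Finset (E × Bool)) = #{h | p h = v} - f v := by
    rw [himg, card_image_of_injective _ hinj, card_univ, Fintype.card_fin]
  have hsum := card_filter_add_card_filter_not (s := ({h | p h = v} : Finset (E × Bool)))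
    (fun h ↦ h.1 ∈ F)
  rw [filter_filter, filter_filter] at hsum
  simp only [and_comm (a := p _ = v)] at hsum
  have := hf v
  omega

/-- At most `#A` classes meet `A`, and all others keep their size when `A` is discarded. -/
theorem card_odd_le {W ι : Type*} [Fintype W] [DecidableEq W] [Fintype ι] [DecidableEq ι]
    (A : Finset W) (P : W → Prop) [DecidablePred P] (c : W → ι) :
    #{i | Odd #{v | P v ∧ c v = i}} ≤ #A + #{i | Odd #{v | P v ∧ v ∉ A ∧ c v = i}} := by
  calc #{i | Odd #{v | P v ∧ c v = i}}
      ≤ #(A.image c ∪ ({i | Odd #{v | P v ∧ v ∉ A ∧ c v = i}} : Finset ι)) := by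
        refine card_le_card fun i hi ↦ ?_
        rw [mem_union]
        by_cases hiA : i ∈ A.image c
        · exact .inl hiA
        · right
          simp only [mem_filter, mem_univ, true_and] at hi ⊢
          have : ({v | P v ∧ v ∉ A ∧ c v = i} : Finset W) =
              ({v | P v ∧ c v = i} : Finset W) := by
            refine filter_congr fun v _ ↦ and_congr_right fun _ ↦ and_iff_right_of_imp ?_
            exact fun h hv ↦ hiA (mem_image.2 ⟨v, hv, h⟩)
          rwa [this]
    _ ≤ _ := (card_union_le _ _).trans (by gcongr; exact card_image_le)

/-- The hard half of the `f`-factor theorem. The components of `V - S - T` are replaced by the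
classes of a labelling `C` that is constant on components. -/
theorem exists_factor_or_barrier [Fintype V] (p : E × Bool → V) (f : V → ℕ)
    (hf : ∀ v, f v < #{h | p h = v}) :
    (∃ F : Finset E, ∀ v, #{h : E × Bool | h.1 ∈ F ∧ p h = v} = f v) ∨
    ∃ (S T : Finset V) (ι : Type (max u w)) (_ : Fintype ι) (_ : DecidableEq ι) (C : V → ι),
      Disjoint S T ∧
      (∀ h, p h ∉ S → p h ∉ T → p (opp h) ∉ S → p (opp h) ∉ T → C (p h) = C (p (opp h))) ∧
      ∑ v ∈ S, f v + #{h | p h ∈ T} < ∑ v ∈ T, f v + #{h | p h ∈ T ∧ p (opp h) ∈ S} +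
        #{i | Odd (∑ v with (v ∉ S ∧ v ∉ T) ∧ C v = i, f v +
          #{h | p h ∈ T ∧ (p (opp h) ∉ S ∧ p (opp h) ∉ T) ∧ C (p (opp h)) = i})} := by
  classical
  rcases (gadget p f).exists_isPerfectMatching_or_isBarrier with ⟨M, hM⟩ | ⟨X, c₀, hX₀⟩
  · exact .inl (exists_factor_of_isPerfectMatching p f (fun v ↦ (hf v).le) hM)
  right
  obtain ⟨Y, c, ⟨hc, hcard⟩, hmin⟩ := hX₀.exists_minimal
  have hpos : ∀ v, 0 < #{h | p h = v} - f v := fun v ↦ Nat.sub_pos_of_lt (hf v)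
  have hexh : ∀ v, ∃ h, p h = v := by
    intro v
    obtain ⟨h, hh⟩ := card_pos.1 ((Nat.zero_le _).trans_lt (hf v))
    exact ⟨h, by simpa using hh⟩
  -- Extra vertices of `v` are twins: if `b'` lies outside `Y`, all neighbours of `b` outside `Y`
  -- lie in the class of `b'`, against minimality.
  have hin : ∀ v (b b' : Fin (#{h | p h = v} - f v)), Sum.inr ⟨v, b⟩ ∈ Y → Sum.inr ⟨v, b'⟩ ∈ Y := by
    intro v b b' hb
    by_contra hb'
    obtain ⟨u, hu, huY, hi, -⟩ := hmin _ hb (c (.inr ⟨v, b'⟩)) (c (.inr ⟨v, b'⟩))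
    rcases u with h | b''
    · exact hi (hc (.inl h) (.inr ⟨v, b'⟩) (show p h = v from hu) huY hb')
    · exact hu
  have hTout : ∀ v (b : Fin (#{h | p h = v} - f v)), Sum.inr ⟨v, b⟩ ∈ Y →
      ∀ h, p h = v → Sum.inl h ∉ Y := by
    intro v b hb h hv hh
    obtain ⟨u, hu, huY, hi, -⟩ := hmin _ hh (c (.inl (opp h))) (c (.inl (opp h)))
    rcases u with h' | ⟨v', b'⟩
    · rw [show h' = opp h from hu] at hi
      exact hi rfl
    · obtain rfl : v' = v := (show p h = v' from hu).symm.trans hv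
      exact huY (hin _ b b' hb)
  -- This is where two classes must be allowed in the minimality condition: outside `Y` the
  -- half-edge `h` sees the extra vertices of `v`, all in the class of `h'`, and `opp h`.
  have hRout : ∀ v, (∀ b : Fin (#{h | p h = v} - f v), Sum.inr ⟨v, b⟩ ∉ Y) →
      ∀ h h', p h = v → p h' = v → Sum.inl h' ∉ Y → Sum.inl h ∉ Y := by
    intro v hb h h' hv hv' hh' hh
    obtain ⟨u, hu, huY, hi, hj⟩ := hmin _ hh (c (.inl h')) (c (.inl (opp h)))
    rcases u with h'' | ⟨v', b'⟩
    · rw [show h'' = opp h from hu] at hj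
      exact hj rfl
    · obtain rfl : v' = v := (show p h = v' from hu).symm.trans hv
      exact hi (hc (.inr ⟨v', b'⟩) (.inl h') (show p h' = v' from hv') huY hh')
  -- So `Y` consists, over `v ∈ S`, of all half-edges and, over `v ∈ T`, of all extra vertices. The
  -- label of `v` is read off its extra vertex number `0`, which exists because `f v < deg v`.
  set S : Finset V := {v | ∀ h, p h = v → Sum.inl h ∈ Y} with hS
  set T : Finset V := {v | ∃ b : Fin (#{h | p h = v} - f v), Sum.inr ⟨v, b⟩ ∈ Y} with hT
  set C : V → Set ((E × Bool) ⊕ (Σ v, Fin (#{h | p h = v} - f v))) :=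
    fun v ↦ c (.inr ⟨v, ⟨0, hpos v⟩⟩) with hC
  have hSmem : ∀ h, p h ∈ S → Sum.inl h ∈ Y := fun h hh ↦ (mem_filter.1 hh).2 h rfl
  have hTmem : ∀ b, b.1 ∈ T → Sum.inr b ∈ Y := by
    rintro ⟨v, b⟩ hv
    obtain ⟨b', hb'⟩ := (mem_filter.1 hv).2
    exact hin v b' b hb'
  have hTmem' : ∀ b, b.1 ∉ T → Sum.inr b ∉ Y := by
    rintro ⟨v, b⟩ hv hb
    exact hv (mem_filter.2 ⟨mem_univ _, b, hb⟩)
  have hSmem' : ∀ h, p h ∉ S → Sum.inl h ∉ Y := by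
    intro h hh
    by_cases hhT : p h ∈ T
    · obtain ⟨b', hb'⟩ := (mem_filter.1 hhT).2
      exact hTout _ b' hb' h rfl
    · have : ∃ h', p h' = p h ∧ Sum.inl h' ∉ Y := by
        by_contra hcon
        push Not at hcon
        exact hh (mem_filter.2 ⟨mem_univ _, hcon⟩)
      obtain ⟨h', hh', hY⟩ := this
      exact hRout (p h) (fun b ↦ hTmem' ⟨p h, b⟩ hhT) h h' rfl hh' hY
  have hST : Disjoint S T := by
    rw [Finset.disjoint_left]
    intro v hvS hvT
    obtain ⟨h, rfl⟩ := hexh v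
    obtain ⟨b', hb'⟩ := (mem_filter.1 hvT).2
    exact hTout _ b' hb' h rfl (hSmem h hvS)
  have hCh : ∀ h, p h ∉ S → p h ∉ T → c (.inl h) = C (p h) := fun h h1 h2 ↦
    hc _ _ (show p h = p h from rfl) (hSmem' h h1) (hTmem' _ h2)
  have hCb : ∀ b, b.1 ∉ S → b.1 ∉ T → c (.inr b) = C b.1 := by
    rintro ⟨v, b⟩ h1 h2
    obtain ⟨h, rfl⟩ := hexh v
    rw [← hCh h h1 h2]
    exact hc _ _ (show p h = p h from rfl) (hTmem' ⟨_, b⟩ h2) (hSmem' h h1)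
  refine ⟨S, T, _, inferInstance, inferInstance, C, hST, ?_, ?_⟩
  · intro h h1 h2 h3 h4
    rw [← hCh h h1 h2, ← hCh _ h3 h4]
    exact hc _ _ (show opp h = opp h from rfl) (hSmem' _ h1) (hSmem' _ h3)
  have hYcard : #Y = #{h | p h ∈ S} + ∑ v ∈ T, (#{h | p h = v} - f v) := by
    have : Y = disjSum {h | p h ∈ S} (T.sigma fun _ ↦ univ) := by
      ext (h | b)
      · simp only [inl_mem_disjSum, mem_filter, mem_univ, true_and]
        exact ⟨fun h1 ↦ by_contra fun h2 ↦ hSmem' h h2 h1, hSmem h⟩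
      · simp only [inr_mem_disjSum, mem_sigma, mem_univ, and_true]
        exact ⟨fun h1 ↦ by_contra fun h2 ↦ hTmem' b h2 h1, hTmem b⟩
    rw [this, card_disjSum, card_sigma]
    simp
  have hfib : ∀ Z : Finset V, #{h | p h ∈ Z} = ∑ v ∈ Z, #{h | p h = v} := by
    intro Z
    rw [card_eq_sum_card_fiberwise (f := p) (t := Z) (by intro h hh; simpa using hh)]
    refine sum_congr rfl fun v hv ↦ ?_
    rw [filter_filter]
    congr 1
    ext h
    simp only [mem_filter, mem_univ, true_and]
    exact ⟨fun h ↦ h.2, fun h ↦ ⟨h ▸ hv, h⟩⟩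
  have hsub : ∀ Z : Finset V, ∑ v ∈ Z, (#{h | p h = v} - f v) + ∑ v ∈ Z, f v = #{h | p h ∈ Z} := by
    intro Z
    rw [hfib, ← sum_add_distrib]
    exact sum_congr rfl fun v _ ↦ Nat.sub_add_cancel (hf v).le
  -- These are isolated once `Y` is removed: half-edges at `T` whose other half is at `S`, and the
  -- extra vertices over `S`.
  set A : Finset ((E × Bool) ⊕ (Σ v, Fin (#{h | p h = v} - f v))) :=
    disjSum {h | p h ∈ T ∧ p (opp h) ∈ S} (S.sigma fun _ ↦ univ) with hA
  have hAcard : #A = #{h | p h ∈ T ∧ p (opp h) ∈ S} + ∑ v ∈ S, (#{h | p h = v} - f v) := by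
    rw [hA, card_disjSum, card_sigma]
    simp
  have hle := card_odd_le A (fun w ↦ w ∉ Y) c
  have hcong : ({i | Odd #{v | v ∉ Y ∧ v ∉ A ∧ c v = i}} : Finset (Set _)) =
      ({i | Odd (∑ v with (v ∉ S ∧ v ∉ T) ∧ C v = i, f v +
          #{h | p h ∈ T ∧ (p (opp h) ∉ S ∧ p (opp h) ∉ T) ∧ C (p (opp h)) = i})} :
            Finset (Set _)) := by
    ext i
    simp only [mem_filter, mem_univ, true_and]
    -- The rest of a class: edges inside `T`, contributing both halves and hence evenly; half-edges
    -- at `T` facing the class; and over each of its vertices `v` outside `S ∪ T`, `deg v`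
    -- half-edges and `deg v - f v` extra vertices, which is `f v` modulo 2.
    have hsplit : ({v | v ∉ Y ∧ v ∉ A ∧ c v = i} : Finset _) =
        disjSum (({h | (p h ∈ T ∧ p (opp h) ∈ T) ∧ c (.inl h) = i} : Finset (E × Bool)) ∪
          (({h | p h ∈ T ∧ (p (opp h) ∉ S ∧ p (opp h) ∉ T) ∧ C (p (opp h)) = i} :
            Finset (E × Bool)) ∪ ({h | p h ∈ ({v | (v ∉ S ∧ v ∉ T) ∧ C v = i} : Finset V)} :
              Finset (E × Bool))))
          (({v | (v ∉ S ∧ v ∉ T) ∧ C v = i} : Finset V).sigma fun _ ↦ univ) := by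
      ext (h | b)
      · simp only [mem_filter, mem_univ, true_and, inl_mem_disjSum, mem_union, hA, not_and]
        have hYS : Sum.inl h ∉ Y ↔ p h ∉ S := ⟨fun h1 h2 ↦ h1 (hSmem h h2), hSmem' h⟩
        rw [hYS]
        by_cases hT1 : p h ∈ T
        · have hS1 : p h ∉ S := fun hS1 ↦ (Finset.disjoint_left.1 hST) hS1 hT1
          by_cases hS2 : p (opp h) ∈ S
          · have := (Finset.disjoint_left.1 hST) hS2
            simp [hT1, hS2, this]
          · by_cases hT2 : p (opp h) ∈ T
            · simp [hT1, hS1, hS2, hT2]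
            · have : c (.inl h) = C (p (opp h)) := by
                rw [← hCh _ hS2 hT2]
                exact hc _ _ (show opp h = opp h from rfl) (hSmem' _ hS1) (hSmem' _ hS2)
              simp [hT1, hS1, hS2, hT2, this]
        · by_cases hS1 : p h ∈ S
          · simp [hT1, hS1]
          · simp [hT1, hS1, hCh h hS1 hT1]
      · simp only [mem_filter, mem_univ, true_and, inr_mem_disjSum, hA, mem_sigma, and_true]
        have hYT : Sum.inr b ∉ Y ↔ b.1 ∉ T := ⟨fun h1 h2 ↦ h1 (hTmem b h2), hTmem' b⟩
        rw [hYT]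
        by_cases hS1 : b.1 ∈ S
        · simp [hS1]
        · by_cases hT1 : b.1 ∈ T
          · simp [hT1]
          · simp [hS1, hT1, hCb b hS1 hT1]
    rw [hsplit, card_disjSum, card_union_of_disjoint, card_union_of_disjoint, card_sigma]
    · have heven : Even #({h | (p h ∈ T ∧ p (opp h) ∈ T) ∧ c (.inl h) = i} :
          Finset (E × Bool)) := by
        refine even_card_of_opp_mem _ fun h hh ↦ ?_
        simp only [mem_filter, mem_univ, true_and, opp_opp] at hh ⊢
        refine ⟨hh.1.symm, ?_⟩
        rw [← hh.2]
        exact (hc (.inl h) (.inl (opp h)) (show opp h = opp h from rfl)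
          (hSmem' _ fun hS1 ↦ (Finset.disjoint_left.1 hST) hS1 hh.1.1)
          (hSmem' _ fun hS1 ↦ (Finset.disjoint_left.1 hST) hS1 hh.1.2)).symm
      have h1 := hsub ({v | (v ∉ S ∧ v ∉ T) ∧ C v = i} : Finset V)
      simp only [card_univ, Fintype.card_fin]
      rw [← h1]
      obtain ⟨m, hm⟩ := heven
      rw [hm]
      generalize #({h | p h ∈ T ∧ (p (opp h) ∉ S ∧ p (opp h) ∉ T) ∧ C (p (opp h)) = i} :
        Finset (E × Bool)) = a
      generalize ∑ v with (v ∉ S ∧ v ∉ T) ∧ C v = i, (#{h | p h = v} - f v) = b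
      generalize ∑ v with (v ∉ S ∧ v ∉ T) ∧ C v = i, f v = d
      simp only [Nat.odd_iff]
      omega
    · rw [Finset.disjoint_left]
      intro h h1 h2
      simp only [mem_filter, mem_univ, true_and] at h1 h2
      exact h2.1.2 h1.1
    · rw [Finset.disjoint_left]
      intro h h1 h2
      simp only [mem_filter, mem_univ, true_and, mem_union] at h1 h2
      rcases h2 with h2 | h2
      · exact h2.2.1.2 h1.1.2
      · exact h2.1.2 h1.1.1
  rw [hcong] at hle
  have hS1 := hsub S
  have hT1 := hsub T
  omega

end HalfEdge

/-! ### Half-edges of a multigraph -/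

namespace Graph

open HalfEdge

variable {α β : Type*}

theorem degree_def (G : Graph α β) (v : α) :
    G.degree v = {e | G.IsNonloopAt e v}.ncard + 2 * (G.loopSet v).ncard := rfl

/-- The vertex of a half-edge, for an arbitrary choice of an orientation. -/
noncomputable def src (G : Graph α β) (h : G.edgeSet × Bool) : α :=
  if h.2 then (G.exists_isLink_of_mem_edgeSet h.1.2).choose
  else (G.exists_isLink_of_mem_edgeSet h.1.2).choose_spec.choose

theorem isLink_src (G : Graph α β) (h : G.edgeSet × Bool) :
    G.IsLink h.1 (G.src h) (G.src (opp h)) := by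
  have := (G.exists_isLink_of_mem_edgeSet h.1.2).choose_spec.choose_spec
  obtain ⟨e, _ | _⟩ := h
  · simpa [src, opp] using this.symm
  · simpa [src, opp] using this

theorem src_mem (G : Graph α β) (h : G.edgeSet × Bool) : G.src h ∈ G.vertexSet :=
  (G.isLink_src h).left_mem

theorem IsLink.exists_src {G : Graph α β} {e : β} {x y : α} (he : G.IsLink e x y) :
    ∃ h : G.edgeSet × Bool, h.1.1 = e ∧ G.src h = x ∧ G.src (opp h) = y := by
  have h1 := G.isLink_src (⟨e, he.edge_mem⟩, true)
  rcases h1.eq_and_eq_or_eq_and_eq he with ⟨h2, h3⟩ | ⟨h2, h3⟩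
  · exact ⟨_, rfl, h2, h3⟩
  · exact ⟨opp (⟨e, he.edge_mem⟩, true), rfl, h3, by simpa using h2⟩

/-- The half-edges of `G` going from `A` to `B` whose edge lies in `F`. -/
def halfEdges (G : Graph α β) (F : Set β) (A B : Set α) : Set (G.edgeSet × Bool) :=
  {h | h.1.1 ∈ F ∧ G.src h ∈ A ∧ G.src (opp h) ∈ B}

/-- The number of half-edges of `G` going from `A` to `B` whose edge lies in `F`. -/
noncomputable def hc (G : Graph α β) (F : Set β) (A B : Set α) : ℕ := (G.halfEdges F A B).ncard

section

variable (G : Graph α β)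

theorem hc_comm (F : Set β) (A B : Set α) : G.hc F A B = G.hc F B A := by
  refine Set.ncard_congr (fun h _ ↦ opp h) ?_ (fun _ _ _ _ h ↦ opp_injective h) ?_
  · rintro h ⟨h1, h2, h3⟩
    exact ⟨h1, h3, by simpa using h2⟩
  · rintro h ⟨h1, h2, h3⟩
    exact ⟨opp h, ⟨h1, h3, by simpa using h2⟩, by simp⟩

theorem hc_univ_right {F : Set β} {A : Set α} : G.hc F A Set.univ = G.hc F A G.vertexSet := by
  rw [hc, hc]
  congr 1
  ext h
  simp [halfEdges, src_mem]

/-- Disjointness ensures that only one of the two halves of an edge goes from `A` to `B`; for `A =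
B` each edge would count twice. -/
theorem ncard_edgesBetween_inter {F : Set β} {A B : Set α} (hAB : Disjoint A B) :
    (G.edgesBetween A B ∩ F).ncard = G.hc F A B := by
  symm
  refine Set.ncard_congr (fun h _ ↦ h.1.1) ?_ ?_ ?_
  · rintro h ⟨h1, h2, h3⟩
    exact ⟨⟨_, h2, _, h3, G.isLink_src h⟩, h1⟩
  · rintro ⟨e, b⟩ ⟨e', b'⟩ ⟨h1, h2, h3⟩ ⟨h1', h2', h3'⟩ hee
    obtain rfl : e = e' := Subtype.ext hee
    by_cases hb : b' = b
    · rw [hb]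
    · exfalso
      have : (e, b') = opp (e, b) := by
        cases b <;> cases b' <;> simp_all [opp]
      rw [this] at h2'
      exact (Set.disjoint_left.1 hAB) h2' h3
  · rintro e ⟨⟨x, hx, y, hy, hl⟩, he⟩
    obtain ⟨h, rfl, rfl, rfl⟩ := hl.exists_src
    exact ⟨h, ⟨he, hx, hy⟩, rfl⟩

theorem ncard_edgesBetween {A B : Set α} (hAB : Disjoint A B) :
    (G.edgesBetween A B).ncard = G.hc Set.univ A B := by
  rw [← ncard_edgesBetween_inter G hAB, Set.inter_univ]

theorem hc_edgeSet {A B : Set α} : G.hc G.edgeSet A B = G.hc Set.univ A B := by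
  rw [hc, hc]
  congr 1
  ext h
  simp [halfEdges]

variable [Finite G.edgeSet]

theorem hc_mono {F F' : Set β} {A A' B B' : Set α} (hF : F ⊆ F') (hA : A ⊆ A') (hB : B ⊆ B') :
    G.hc F A B ≤ G.hc F' A' B' :=
  Set.ncard_le_ncard (fun _ h ↦ ⟨hF h.1, hA h.2.1, hB h.2.2⟩) (Set.toFinite _)

theorem hc_union_left {F : Set β} {A A' B : Set α} (hA : Disjoint A A') :
    G.hc F (A ∪ A') B = G.hc F A B + G.hc F A' B := by
  rw [hc, hc, hc, ← Set.ncard_union_eq _ (Set.toFinite _) (Set.toFinite _)]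
  · congr 1
    ext h
    simp only [halfEdges, Set.mem_ofPred_eq, Set.mem_union]
    tauto
  · rw [Set.disjoint_left] at hA ⊢
    exact fun h h1 h2 ↦ hA h1.2.1 h2.2.1

theorem hc_union_right {F : Set β} {A B B' : Set α} (hB : Disjoint B B') :
    G.hc F A (B ∪ B') = G.hc F A B + G.hc F A B' := by
  rw [hc_comm, hc_union_left G hB, hc_comm _ _ B, hc_comm _ _ B']

theorem hc_biUnion_right {F : Set β} {A : Set α} (𝒬 : Finset (Set α))
    (h𝒬 : ∀ Q ∈ 𝒬, ∀ Q' ∈ 𝒬, ∀ x, x ∈ Q → x ∈ Q' → Q = Q') :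
    G.hc F A (⋃ Q ∈ 𝒬, Q) = ∑ Q ∈ 𝒬, G.hc F A Q := by
  classical
  induction 𝒬 using Finset.induction_on with
  | empty => simp [hc, halfEdges]
  | insert Q 𝒬 hQ ih =>
    rw [Finset.sum_insert hQ, ← ih fun Q hQ Q' hQ' ↦
      h𝒬 Q (Finset.mem_insert_of_mem hQ) Q' (Finset.mem_insert_of_mem hQ'), ← hc_union_right]
    · simp
    · rw [Set.disjoint_left]
      intro x hx hx'
      simp only [Set.mem_iUnion] at hx'
      obtain ⟨Q', hQ', hx'⟩ := hx'
      rw [h𝒬 Q (Finset.mem_insert_self _ _) Q' (Finset.mem_insert_of_mem hQ') x hx hx'] at hQ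
      exact hQ hQ'

theorem hc_eq_zero_iff {F : Set β} {A B : Set α} :
    G.hc F A B = 0 ↔ ∀ e ∈ F, ∀ x ∈ A, ∀ y ∈ B, ¬ G.IsLink e x y := by
  rw [hc, Set.ncard_eq_zero (Set.toFinite _), Set.eq_empty_iff_forall_notMem]
  constructor
  · intro hh e he x hx y hy hl
    obtain ⟨h, rfl, rfl, rfl⟩ := hl.exists_src
    exact hh h ⟨he, hx, hy⟩
  · rintro hh h ⟨h1, h2, h3⟩
    exact hh _ h1 _ h2 _ h3 (G.isLink_src h)

theorem even_hc_self (F : Set β) (A : Set α) : Even (G.hc F A A) := by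
  classical
  have := Fintype.ofFinite G.edgeSet
  rw [hc, Set.ncard_eq_toFinset_card']
  refine even_card_of_opp_mem _ fun h hh ↦ ?_
  rw [Set.mem_toFinset] at hh ⊢
  exact ⟨hh.1, hh.2.2, by simpa using hh.2.1⟩

/-- A loop has both halves at `v`, which accounts for the factor 2. Degrees in a subgraph are
counted by half-edges of the ambient `G`, so that `G` and a putative factor share one system of
half-edges. -/
theorem degree_eq_hc {K : Graph α β} (hK : K ≤ G) (v : α) :
    K.degree v = G.hc K.edgeSet {v} Set.univ := by
  have hsplit : G.halfEdges K.edgeSet {v} Set.univ =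
      {h | h.1.1 ∈ K.edgeSet ∧ G.src h = v ∧ G.src (opp h) ≠ v} ∪
      {h | h.1.1 ∈ K.edgeSet ∧ G.src h = v ∧ G.src (opp h) = v} := by
    ext h
    simp only [halfEdges, Set.mem_ofPred_eq, Set.mem_union, Set.mem_singleton_iff, Set.mem_univ]
    tauto
  rw [hc, hsplit, Set.ncard_union_eq _ (Set.toFinite _) (Set.toFinite _), degree_def]
  · congr 1
    · symm
      refine Set.ncard_congr (fun h _ ↦ h.1.1) ?_ ?_ ?_
      · rintro h ⟨h1, h2, h3⟩
        have := G.isLink_src h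
        rw [h2] at this
        exact ⟨_, h3, (hK.isLink_iff h1).2 this⟩
      · rintro ⟨e, b⟩ ⟨e', b'⟩ ⟨h1, h2, h3⟩ ⟨h1', h2', h3'⟩ hee
        obtain rfl : e = e' := Subtype.ext hee
        by_cases hb : b' = b
        · rw [hb]
        · exfalso
          have : (e, b') = opp (e, b) := by
            cases b <;> cases b' <;> simp_all [opp]
          rw [this] at h2'
          exact h3 h2'
      · rintro e ⟨y, hy, hl⟩
        obtain ⟨h, rfl, rfl, rfl⟩ := (hl.mono hK).exists_src
        exact ⟨h, ⟨hl.edge_mem, rfl, hy⟩, rfl⟩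
    · have hfin : Set.Finite (K.loopSet v) := by
        refine (Set.toFinite G.edgeSet).subset ?_
        exact fun e he ↦ (IsLink.mono hK he).edge_mem
      have h2 : 2 * (K.loopSet v).ncard = (K.loopSet v ×ˢ (Set.univ : Set Bool)).ncard := by
        rw [Set.ncard_prod, Set.ncard_univ, Nat.card_eq_fintype_card, Fintype.card_bool, mul_comm]
      rw [h2]
      symm
      refine Set.ncard_congr (fun h _ ↦ (h.1.1, h.2)) ?_ ?_ ?_
      · rintro h ⟨h1, h2, h3⟩
        have := G.isLink_src h
        rw [h2, h3] at this
        exact ⟨(hK.isLink_iff h1).2 this, trivial⟩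
      · rintro ⟨e, b⟩ ⟨e', b'⟩ _ _ hee
        simp only [Prod.mk.injEq] at hee
        exact Prod.ext (Subtype.ext hee.1) hee.2
      · rintro ⟨e, b⟩ ⟨hl, -⟩
        have hl' : G.IsLink e v v := IsLink.mono hK hl
        refine ⟨(⟨e, hl'.edge_mem⟩, b), ⟨IsLink.edge_mem hl, ?_, ?_⟩, rfl⟩
        · rcases (G.isLink_src (⟨e, hl'.edge_mem⟩, b)).left_eq_or_eq hl' with h | h <;> exact h
        · rcases (G.isLink_src (⟨e, hl'.edge_mem⟩, b)).right_eq_or_eq hl' with h | h <;> exact h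
  · rw [Set.disjoint_left]
    exact fun h h1 h2 ↦ h1.2.2 h2.2.2

theorem hc_eq_mul_ncard {K : Graph α β} (hK : K ≤ G) {d : ℕ} {A : Set α} (hA : A.Finite)
    (hd : ∀ v ∈ A, K.degree v = d) : G.hc K.edgeSet A Set.univ = d * A.ncard := by
  induction A, hA using Set.Finite.induction_on with
  | empty => simp [hc, halfEdges]
  | @insert v A hv hA ih =>
    rw [Set.ncard_insert_of_notMem hv hA, mul_add, mul_one,
      ← ih fun w hw ↦ hd w (Set.mem_insert_of_mem _ hw), Set.insert_eq, hc_union_left,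
      ← degree_eq_hc G hK, hd v (Set.mem_insert _ _), add_comm]
    simpa using hv

end

/-! ### Reachability, components and cut-edges -/

section

variable {G : Graph α β}

theorem Reachable.symm {x y : α} (h : G.Reachable x y) : G.Reachable y x := by
  induction h with
  | refl => exact .refl
  | tail _ h ih => exact .head h.symm ih

theorem Reachable.trans {x y z : α} (h : G.Reachable x y) (h' : G.Reachable y z) :
    G.Reachable x z :=
  Relation.ReflTransGen.trans h h'

theorem Reachable.mem_of_closed {x y : α} (h : G.Reachable x y) {X : Set α}
    (hX : ∀ e a b, G.IsLink e a b → a ∈ X → b ∈ X) (hx : x ∈ X) : y ∈ X := by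
  induction h with
  | refl => exact hx
  | tail _ h ih =>
    obtain ⟨e, he⟩ := h
    exact hX e _ _ he ih

/-- The set of vertices reachable from one end after deleting `e` serves as `X`. Conversely any `X`
left by `e` alone traps walks in the graph without `e`. -/
theorem isCutEdge_iff {e : β} : G.IsCutEdge e ↔ ∃ (X : Set α) (x y : α), G.IsLink e x y ∧
    x ∈ X ∧ y ∉ X ∧ ∀ f a b, G.IsLink f a b → a ∈ X → b ∉ X → f = e := by
  constructor
  · rintro ⟨x, y, he, hr⟩
    refine ⟨{z | (G.deleteEdges {e}).Reachable x z}, x, y, he, .refl, hr, ?_⟩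
    intro f a b hf ha hb
    by_contra hfe
    exact hb (ha.tail ⟨f, by simp [hf, hfe]⟩)
  · rintro ⟨X, x, y, he, hx, hy, hX⟩
    refine ⟨x, y, he, fun hr ↦ hy (hr.mem_of_closed ?_ hx)⟩
    intro f a b hf ha
    by_contra hb
    rw [deleteEdges_isLink] at hf
    exact hf.2 (hX f a b hf.1 ha hb)

/-- A cut-edge is the only edge leaving some set that contains a prescribed end of it. -/
theorem IsCutEdge.exists_separating {e : β} (he : G.IsCutEdge e) {x y : α}
    (hxy : G.IsLink e x y) : ∃ X : Set α, x ∈ X ∧ y ∉ X ∧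
      ∀ f a b, G.IsLink f a b → a ∈ X → b ∉ X → f = e := by
  obtain ⟨X, x', y', hl, hx', hy', hX⟩ := isCutEdge_iff.1 he
  rcases hl.eq_and_eq_or_eq_and_eq hxy with ⟨rfl, rfl⟩ | ⟨rfl, rfl⟩
  · exact ⟨X, hx', hy', hX⟩
  · exact ⟨Xᶜ, hy', fun h ↦ h hx', fun f a b hf ha hb ↦
      hX f b a hf.symm (not_not.1 hb) ha⟩

variable {R Q Q' : Set α}

theorem IsComponent.subset (hQ : (G.induce R).IsComponent Q) : Q ⊆ R := by
  obtain ⟨x, hx, rfl⟩ := hQ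
  exact fun y hy ↦ Reachable.mem_of_closed hy (X := R) (fun e a b h _ ↦ h.2.2) hx

theorem IsComponent.nonempty (hQ : G.IsComponent Q) : Q.Nonempty := by
  obtain ⟨x, hx, rfl⟩ := hQ
  exact ⟨x, .refl⟩

theorem IsComponent.eq_of_mem (hQ : G.IsComponent Q) (hQ' : G.IsComponent Q') {x : α}
    (hx : x ∈ Q) (hx' : x ∈ Q') : Q = Q' := by
  obtain ⟨y, hy, rfl⟩ := hQ
  obtain ⟨z, hz, rfl⟩ := hQ'
  ext w
  exact ⟨fun hw ↦ (Reachable.trans hx' hx.symm).trans hw,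
    fun hw ↦ (Reachable.trans hx hx'.symm).trans hw⟩

theorem exists_isComponent_mem {x : α} (hx : x ∈ G.vertexSet) :
    ∃ Q, G.IsComponent Q ∧ x ∈ Q :=
  ⟨_, ⟨x, hx, rfl⟩, .refl⟩

theorem IsComponent.mem_of_isLink (hQ : (G.induce R).IsComponent Q) {e : β} {x y : α}
    (he : G.IsLink e x y) (hx : x ∈ Q) (hy : y ∈ R) : y ∈ Q := by
  have hxR := hQ.subset hx
  obtain ⟨z, hz, rfl⟩ := hQ
  exact Relation.ReflTransGen.tail hx ⟨e, he, hxR, hy⟩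

/-- A set that no edge inside the component `Q` leaves contains `Q` if it meets `Q`. -/
theorem IsComponent.subset_of_closed (hQ : (G.induce R).IsComponent Q) {X : Set α}
    (hX : ∀ e a b, G.IsLink e a b → a ∈ Q → b ∈ Q → a ∈ X → b ∈ X) {x : α} (hxQ : x ∈ Q)
    (hxX : x ∈ X) : Q ⊆ X := by
  intro y hyQ
  have hr : (G.induce R).Reachable x y := by
    obtain ⟨z, hz, rfl⟩ := hQ
    exact Reachable.trans (Reachable.symm hxQ) hyQ
  have := hr.mem_of_closed (X := X ∩ Q) ?_ ⟨hxX, hxQ⟩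
  · exact this.1
  · rintro e a b ⟨he, haR, hbR⟩ ⟨haX, haQ⟩
    have hbQ := hQ.mem_of_isLink he haQ hbR
    exact ⟨hX e a b he haQ hbQ haX, hbQ⟩

end

end Graph

/-! ### Counting across a partition into `R`, `S`, `T` -/

namespace Graph

open HalfEdge

variable {α β : Type*} {G : Graph α β} {R S T Q X : Set α} {d : ℕ}

theorem finite_setOf_isComponent (hR : R.Finite) : {Q | (G.induce R).IsComponent Q}.Finite :=
  hR.finite_subsets.subset fun _ hQ ↦ IsComponent.subset hQ

theorem biUnion_components (hR : R.Finite) :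
    ⋃ Q ∈ (finite_setOf_isComponent (G := G) hR).toFinset, Q = R := by
  ext x
  simp only [Set.Finite.mem_toFinset, Set.mem_ofPred_eq, Set.mem_iUnion, exists_prop]
  constructor
  · rintro ⟨Q, hQ, hx⟩
    exact hQ.subset hx
  · intro hx
    exact exists_isComponent_mem (G := G.induce R) hx

theorem hc_components [Finite G.edgeSet] (hR : R.Finite) (F : Set β) (A : Set α) :
    G.hc F A R = ∑ Q ∈ (finite_setOf_isComponent (G := G) hR).toFinset, G.hc F A Q := by
  conv_lhs => rw [← biUnion_components (G := G) hR]
  refine hc_biUnion_right G _ ?_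
  intro Q hQ Q' hQ' x hx hx'
  rw [Set.Finite.mem_toFinset] at hQ hQ'
  exact hQ.eq_of_mem hQ' hx hx'

open Classical in
/-- The components inside a set that no edge of `G[R]` leaves. -/
theorem hc_components_inter [Finite G.edgeSet] (hR : R.Finite) (F : Set β) (A : Set α)
    (hX : ∀ e a b, G.IsLink e a b → a ∈ R → b ∈ R → a ∈ X → b ∈ X) :
    G.hc F A (R ∩ X) =
      ∑ Q ∈ (finite_setOf_isComponent (G := G) hR).toFinset with Q ⊆ X, G.hc F A Q := by
  rw [← hc_biUnion_right G _ ?_]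
  · congr 1
    ext x
    simp only [Set.mem_inter_iff, Finset.mem_filter, Set.Finite.mem_toFinset, Set.mem_ofPred_eq,
      Set.mem_iUnion, exists_prop]
    constructor
    · rintro ⟨hxR, hxX⟩
      obtain ⟨Q, hQ, hx⟩ := exists_isComponent_mem (G := G.induce R) hxR
      refine ⟨Q, ⟨hQ, hQ.subset_of_closed ?_ hx hxX⟩, hx⟩
      exact fun e a b h ha hb ↦ hX e a b h (hQ.subset ha) (hQ.subset hb)
    · rintro ⟨Q, ⟨hQ, hQX⟩, hx⟩
      exact ⟨hQ.subset hx, hQX hx⟩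
  · intro Q hQ Q' hQ' x hx hx'
    simp only [Finset.mem_filter, Set.Finite.mem_toFinset, Set.mem_ofPred_eq] at hQ hQ'
    exact hQ.1.eq_of_mem hQ'.1 hx hx'

/-- `R`, `S`, `T` partition the vertex set. -/
structure IsPartition (G : Graph α β) (R S T : Set α) : Prop where
  union_eq : R ∪ S ∪ T = G.vertexSet
  disjoint_RS : Disjoint R S
  disjoint_RT : Disjoint R T
  disjoint_ST : Disjoint S T

namespace IsPartition

theorem hc_univ [Finite G.edgeSet] (hP : G.IsPartition R S T) (F : Set β) (A : Set α) :
    G.hc F A Set.univ = G.hc F A R + G.hc F A S + G.hc F A T := by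
  rw [hc_univ_right, ← hP.union_eq, hc_union_right, hc_union_right]
  · exact hP.disjoint_RS
  · exact Set.disjoint_union_left.2 ⟨hP.disjoint_RT, hP.disjoint_ST⟩

theorem subset_R (hP : G.IsPartition R S T) : R ⊆ G.vertexSet := by
  rw [← hP.union_eq]; exact fun x hx ↦ .inl (.inl hx)

theorem subset_S (hP : G.IsPartition R S T) : S ⊆ G.vertexSet := by
  rw [← hP.union_eq]; exact fun x hx ↦ .inl (.inr hx)

theorem subset_T (hP : G.IsPartition R S T) : T ⊆ G.vertexSet := by
  rw [← hP.union_eq]; exact fun x hx ↦ .inr hx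

theorem cases (hP : G.IsPartition R S T) {x : α} (hx : x ∈ G.vertexSet) :
    x ∈ R ∨ x ∈ S ∨ x ∈ T := by
  rw [← hP.union_eq] at hx
  rcases hx with (h | h) | h <;> simp [h]

theorem disjoint_SQ (hP : G.IsPartition R S T) (hQ : (G.induce R).IsComponent Q) :
    Disjoint S Q :=
  (hP.disjoint_RS.mono_left hQ.subset).symm

theorem disjoint_TQ (hP : G.IsPartition R S T) (hQ : (G.induce R).IsComponent Q) :
    Disjoint T Q :=
  (hP.disjoint_RT.mono_left hQ.subset).symm

theorem hc_component [Finite G.edgeSet] (hP : G.IsPartition R S T)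
    (hQ : (G.induce R).IsComponent Q) (F : Set β) :
    G.hc F Q Set.univ = G.hc F Q Q + G.hc F S Q + G.hc F T Q := by
  rw [hP.hc_univ, hc_comm G F S, hc_comm G F T]
  congr 2
  rw [hc, hc]
  congr 1
  ext h
  refine ⟨fun hh ↦ ⟨hh.1, hh.2.1, hQ.mem_of_isLink (G.isLink_src h) hh.2.1 hh.2.2⟩,
    fun hh ↦ ⟨hh.1, hh.2.1, hQ.subset hh.2.2⟩⟩

/-- The degree equation over the whole graph. -/
theorem degree_sum [Finite G.edgeSet] (hP : G.IsPartition R S T) (hV : G.vertexSet.Finite)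
    {K : Graph α β} (hK : K ≤ G) (hd : ∀ v ∈ G.vertexSet, K.degree v = d) :
    (d : ℤ) * (T.ncard - S.ncard) =
      G.hc K.edgeSet T T + G.hc K.edgeSet T R - G.hc K.edgeSet S S - G.hc K.edgeSet S R := by
  have hT := hc_eq_mul_ncard G hK (hV.subset hP.subset_T) fun v hv ↦ hd v (hP.subset_T hv)
  have hS := hc_eq_mul_ncard G hK (hV.subset hP.subset_S) fun v hv ↦ hd v (hP.subset_S hv)
  rw [hP.hc_univ] at hT hS
  rw [hc_comm G K.edgeSet S T] at hS
  zify at hT hS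
  linarith

/-- The degree equation on the side `X` of a cut-edge from `T` to a component of `G[R]`. -/
theorem degree_sum_side [Finite G.edgeSet] (hP : G.IsPartition R S T) (hV : G.vertexSet.Finite)
    (hd : G.IsRegular d) (hS : G.IsIndependent S) (hT : G.IsIndependent T)
    {e : β} {t q : α} (he : G.IsLink e t q) (ht : t ∈ T) (hq : q ∈ R) (hqX : q ∈ X)
    (htX : t ∉ X) (hX : ∀ f a b, G.IsLink f a b → a ∈ X → b ∉ X → f = e) :
    (d : ℤ) * ((T ∩ X).ncard - (S ∩ X).ncard) + 1 =
      G.hc Set.univ T (R ∩ X) - G.hc Set.univ S (R ∩ X) := by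
  have hRT := Set.disjoint_left.1 hP.disjoint_RT
  have hRS := Set.disjoint_left.1 hP.disjoint_RS
  have hST := Set.disjoint_left.1 hP.disjoint_ST
  have hends : ∀ a b, G.IsLink e a b → a ∈ X → b ∉ X → a = q ∧ b = t := by
    intro a b hab ha hb
    rcases hab.eq_and_eq_or_eq_and_eq he with ⟨rfl, rfl⟩ | ⟨rfl, rfl⟩
    · exact (htX ha).elim
    · exact ⟨rfl, rfl⟩
  have hcross : ∀ f a b, G.IsLink f a b → a ∈ X → b ∉ X → a = q ∧ b = t ∧ f = e := by
    intro f a b hab ha hb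
    obtain rfl := hX f a b hab ha hb
    exact ⟨(hends a b hab ha hb).1, (hends a b hab ha hb).2, rfl⟩
  have h1 := hc_eq_mul_ncard G le_rfl (hV.subset (Set.inter_subset_left.trans hP.subset_T))
    (A := T ∩ X) fun v hv ↦ hd v (hP.subset_T hv.1)
  have h2 := hc_eq_mul_ncard G le_rfl (hV.subset (Set.inter_subset_left.trans hP.subset_S))
    (A := S ∩ X) fun v hv ↦ hd v (hP.subset_S hv.1)
  rw [hP.hc_univ] at h1 h2
  simp only [hc_edgeSet] at h1 h2
  have hsplit : ∀ A Z : Set α, G.hc Set.univ A Z =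
      G.hc Set.univ A (Z ∩ X) + G.hc Set.univ A (Z \ X) := by
    intro A Z
    rw [← hc_union_right G (Set.disjoint_left.2 fun x hx hx' ↦ hx'.2 hx.2), Set.inter_union_sdiff]
  have hTT : G.hc Set.univ (T ∩ X) T = 0 := by
    rw [hc_eq_zero_iff]
    exact fun f _ x hx y hy hl ↦ hT x hx.1 y hy ⟨f, hl⟩
  have hSS : G.hc Set.univ (S ∩ X) S = 0 := by
    rw [hc_eq_zero_iff]
    exact fun f _ x hx y hy hl ↦ hS x hx.1 y hy ⟨f, hl⟩
  have z1 : G.hc Set.univ (T ∩ X) (S \ X) = 0 := by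
    rw [hc_eq_zero_iff]
    rintro f - x hx y hy hl
    exact hST hy.1 ((hcross f x y hl hx.2 hy.2).2.1 ▸ ht)
  have z2 : G.hc Set.univ (S ∩ X) (T \ X) = 0 := by
    rw [hc_eq_zero_iff]
    rintro f - x hx y hy hl
    exact hRS ((hcross f x y hl hx.2 hy.2).1 ▸ hq) hx.1
  have z3 : G.hc Set.univ (T ∩ X) (R \ X) = 0 := by
    rw [hc_eq_zero_iff]
    rintro f - x hx y hy hl
    exact hRT hy.1 ((hcross f x y hl hx.2 hy.2).2.1 ▸ ht)
  have z4 : G.hc Set.univ (S ∩ X) (R \ X) = 0 := by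
    rw [hc_eq_zero_iff]
    rintro f - x hx y hy hl
    exact hRS ((hcross f x y hl hx.2 hy.2).1 ▸ hq) hx.1
  have z5 : G.hc Set.univ (R ∩ X) (S \ X) = 0 := by
    rw [hc_eq_zero_iff]
    rintro f - x hx y hy hl
    exact hST hy.1 ((hcross f x y hl hx.2 hy.2).2.1 ▸ ht)
  -- The edge `e` itself enters `R ∩ X` from a vertex of `T` outside `X`; this is the `+ 1` of the
  -- equation.
  have z6 : G.hc Set.univ (T \ X) (R ∩ X) = 1 := by
    rw [← ncard_edgesBetween, Set.ncard_eq_one]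
    · refine ⟨e, Set.eq_singleton_iff_unique_mem.2 ⟨⟨t, ⟨ht, htX⟩, q, ⟨hq, hqX⟩, he⟩, ?_⟩⟩
      rintro f ⟨x, hx, y, hy, hl⟩
      exact (hcross f y x hl.symm hy.2 hx.2).2.2
    · exact Set.disjoint_left.2 fun x hx hx' ↦ hx.2 hx'.2
  have e1 := hsplit (R ∩ X) T
  have e2 := hsplit (R ∩ X) S
  rw [z5, add_zero] at e2
  rw [hc_comm G _ _ T, hc_comm G _ _ (T ∩ X), hc_comm G _ _ (T \ X), z6] at e1
  rw [hc_comm G _ _ S, hc_comm G _ _ (S ∩ X)] at e2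
  rw [hsplit _ R, z3, hsplit _ S, z1, hTT] at h1
  rw [hsplit _ R, z4, hsplit _ T, z2, hSS, hc_comm G _ (S ∩ X) (T ∩ X)] at h2
  zify at h1 h2 e1 e2
  linarith

/-- If `|T| = |S| + 1`, a component joined to `T` by a cut-edge is joined to `T` by at most one
edge more than to `S`. -/
theorem hc_le_of_isCutEdge [Finite G.edgeSet] (hP : G.IsPartition R S T)
    (hV : G.vertexSet.Finite) (hd : G.IsRegular d) (hd0 : 0 < d) (hS : G.IsIndependent S)
    (hT : G.IsIndependent T) (hcard : T.ncard = S.ncard + 1)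
    (hle : ∀ Q, (G.induce R).IsComponent Q → G.hc Set.univ S Q ≤ G.hc Set.univ T Q)
    (hQ : (G.induce R).IsComponent Q) {e : β} (he : G.IsCutEdge e)
    (heQ : e ∈ G.edgesBetween T Q) : G.hc Set.univ T Q ≤ G.hc Set.univ S Q + 1 := by
  classical
  have hRT := Set.disjoint_left.1 hP.disjoint_RT
  obtain ⟨t, ht, q, hq, hl⟩ := heQ
  obtain ⟨X, hqX, htX, hX⟩ := he.exists_separating hl.symm
  have hside := hP.degree_sum_side hV hd hS hT hl ht (hQ.subset hq) hqX htX hX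
  have hR := hV.subset hP.subset_R
  have hin : ∀ a b, G.IsLink e a b → a ∈ R → b ∉ R := by
    intro a b hab ha hb
    rcases hab.eq_and_eq_or_eq_and_eq hl with ⟨rfl, rfl⟩ | ⟨rfl, rfl⟩
    · exact hRT ha ht
    · exact hRT hb ht
  have hclosed : ∀ f a b, G.IsLink f a b → a ∈ R → b ∈ R → a ∈ X → b ∈ X := by
    intro f a b hf ha hb haX
    by_contra hbX
    obtain rfl := hX f a b hf haX hbX
    exact hin a b hf ha hb
  have hQX : Q ⊆ X := hQ.subset_of_closed
    (fun f a b hf ha hb ↦ hclosed f a b hf (hQ.subset ha) (hQ.subset hb)) hq hqX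
  rw [hc_components_inter hR _ _ hclosed, hc_components_inter hR _ _ hclosed] at hside
  have htot := hP.degree_sum hV le_rfl hd
  simp only [hc_edgeSet] at htot
  have hTT : G.hc Set.univ T T = 0 := by
    rw [hc_eq_zero_iff]
    exact fun f _ x hx y hy hl ↦ hT x hx y hy ⟨f, hl⟩
  have hSS : G.hc Set.univ S S = 0 := by
    rw [hc_eq_zero_iff]
    exact fun f _ x hx y hy hl ↦ hS x hx y hy ⟨f, hl⟩
  rw [hTT, hSS, hcard, hc_components hR, hc_components hR] at htot
  set 𝒬 := (finite_setOf_isComponent (G := G) hR).toFinset with h𝒬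
  have hmem : ∀ Q, Q ∈ 𝒬 ↔ (G.induce R).IsComponent Q := by simp [h𝒬]
  push_cast at hside htot
  rw [← Finset.sum_filter_add_sum_filter_not 𝒬 (· ⊆ X) (fun Q ↦ (G.hc Set.univ T Q : ℤ)),
    ← Finset.sum_filter_add_sum_filter_not 𝒬 (· ⊆ X) (fun Q ↦ (G.hc Set.univ S Q : ℤ))] at htot
  have hrest : ∑ Q ∈ 𝒬 with ¬ Q ⊆ X, (G.hc Set.univ S Q : ℤ) ≤
      ∑ Q ∈ 𝒬 with ¬ Q ⊆ X, (G.hc Set.univ T Q : ℤ) :=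
    Finset.sum_le_sum fun Q' hQ' ↦ by
      exact_mod_cast hle Q' ((hmem Q').1 (Finset.mem_filter.1 hQ').1)
  have hone : (G.hc Set.univ T Q : ℤ) - G.hc Set.univ S Q ≤
      ∑ Q ∈ 𝒬 with Q ⊆ X, ((G.hc Set.univ T Q : ℤ) - G.hc Set.univ S Q) := by
    refine Finset.single_le_sum (f := fun Q ↦ (G.hc Set.univ T Q : ℤ) - G.hc Set.univ S Q) ?_ ?_
    · intro Q' hQ'
      have := hle Q' ((hmem Q').1 (Finset.mem_filter.1 hQ').1)
      simp only [sub_nonneg]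
      exact_mod_cast this
    · exact Finset.mem_filter.2 ⟨(hmem Q).2 hQ, hQX⟩
  rw [Finset.sum_sub_distrib] at hone
  set D : ℤ := (T ∩ X).ncard - (S ∩ X).ncard with hD
  -- The excesses of edges to `T` over edges to `S` are nonnegative and total `d` over all
  -- components, while those inside `X` total `d * D + 1`. So `d * D + 1 ≤ d`, hence `D ≤ 0`, and
  -- the excess inside `X` is at most 1.
  have hD0 : D ≤ 0 := by
    by_contra hcon
    have : (1 : ℤ) ≤ D := by omega
    have : (d : ℤ) * 1 ≤ d * D := by gcongr
    linarith
  have : (d : ℤ) * D ≤ 0 := mul_nonpos_of_nonneg_of_nonpos (by positivity) hD0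
  have : (G.hc Set.univ T Q : ℤ) ≤ G.hc Set.univ S Q + 1 := by linarith
  exact_mod_cast this

end IsPartition

/-- A subgraph whose degrees are even contains no cut-edge. -/
theorem IsCutEdge.notMem_edgeSet [Finite G.edgeSet] (hV : G.vertexSet.Finite) {e : β}
    (he : G.IsCutEdge e) {K : Graph α β} (hK : K ≤ G) {k : ℕ}
    (hd : ∀ v ∈ G.vertexSet, K.degree v = 2 * k) : e ∉ K.edgeSet := by
  intro heK
  obtain ⟨X, x, y, hl, hx, hy, hX⟩ := isCutEdge_iff.1 he
  have hdisj : Disjoint (X ∩ G.vertexSet) (X ∩ G.vertexSet)ᶜ := disjoint_compl_right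
  have h1 := hc_eq_mul_ncard G hK (hV.subset Set.inter_subset_right) (A := X ∩ G.vertexSet)
    fun v hv ↦ hd v hv.2
  rw [← Set.union_compl_self (X ∩ G.vertexSet), hc_union_right G hdisj,
    ← ncard_edgesBetween_inter G hdisj] at h1
  have h2 : G.edgesBetween (X ∩ G.vertexSet) (X ∩ G.vertexSet)ᶜ ∩ K.edgeSet = {e} := by
    refine Set.eq_singleton_iff_unique_mem.2
      ⟨⟨⟨x, ⟨hx, hl.left_mem⟩, y, fun h ↦ hy h.1, hl⟩, heK⟩, ?_⟩
    rintro f ⟨⟨a, ha, b, hb, hf⟩, -⟩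
    exact hX f a b hf ha.1 fun h ↦ hb ⟨h, hf.right_mem⟩
  rw [h2, Set.ncard_singleton] at h1
  -- The degree sum of `K` over one side is even, but it would be an even number of internal
  -- half-edges plus the single half of `e`.
  have h3 := even_hc_self G K.edgeSet (X ∩ G.vertexSet)
  have h4 : Even (2 * k * (X ∩ G.vertexSet).ncard) := by
    rw [mul_assoc]; exact even_two_mul _
  rw [← h1] at h4
  exact (Nat.not_even_iff_odd.2 h3.add_one) h4

end Graph

/-! ### Partitions that exclude a factor -/

namespace Graph

open HalfEdge

variable {α β : Type*} {G : Graph α β} {R S T Q : Set α} {d : ℕ}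

/-- The graph on `Q` already uses up all `d * |Q|` half-edges at `Q`. -/
theorem IsPartition.hc_eq_zero_of_isRegular_induce [Finite G.edgeSet] (hP : G.IsPartition R S T)
    (hV : G.vertexSet.Finite) (hd : G.IsRegular d) (hQ : (G.induce R).IsComponent Q)
    (hQd : (G.induce Q).IsRegular d) :
    G.hc Set.univ S Q = 0 ∧ G.hc Set.univ T Q = 0 := by
  have hQV : Q ⊆ G.vertexSet := hQ.subset.trans hP.subset_R
  have h1 := hc_eq_mul_ncard G (induce_le hQV) (hV.subset hQV) hQd
  have h2 := hc_eq_mul_ncard G le_rfl (hV.subset hQV) fun v hv ↦ hd v (hQV hv)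
  rw [hP.hc_component hQ, hc_edgeSet, hc_edgeSet, hc_edgeSet] at h2
  have h3 : G.hc (G.induce Q).edgeSet Q Set.univ ≤ G.hc Set.univ Q Q := by
    refine Set.ncard_le_ncard ?_ (Set.toFinite _)
    rintro h ⟨⟨x, y, hl, hx, hy⟩, hh, -⟩
    refine ⟨trivial, hh, ?_⟩
    rcases (G.isLink_src h).right_eq_or_eq hl with h' | h' <;> rw [h'] <;> assumption
  omega

theorem IsPartition.even_hc_add [Finite G.edgeSet] (hP : G.IsPartition R S T)
    (hV : G.vertexSet.Finite) {K : Graph α β} (hK : K ≤ G) {k : ℕ}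
    (hd : ∀ v ∈ G.vertexSet, K.degree v = 2 * k) (hQ : (G.induce R).IsComponent Q) :
    Even (G.hc K.edgeSet S Q + G.hc K.edgeSet T Q) := by
  have hQV : Q ⊆ G.vertexSet := hQ.subset.trans hP.subset_R
  have h2 := hc_eq_mul_ncard G hK (hV.subset hQV) fun v hv ↦ hd v (hQV hv)
  rw [hP.hc_component hQ] at h2
  obtain ⟨m, hm⟩ := even_hc_self G K.edgeSet Q
  rw [hm, mul_assoc] at h2
  rw [Nat.even_iff]
  omega

theorem IsPartition.hc_lt_of_isCutEdge [Finite G.edgeSet] (hP : G.IsPartition R S T)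
    (hV : G.vertexSet.Finite) {K : Graph α β} (hK : K ≤ G) {k : ℕ}
    (hd : ∀ v ∈ G.vertexSet, K.degree v = 2 * k) (hQ : (G.induce R).IsComponent Q) {e : β}
    (he : G.IsCutEdge e) (heQ : e ∈ G.edgesBetween T Q) :
    G.hc K.edgeSet T Q < G.hc Set.univ T Q := by
  rw [← ncard_edgesBetween_inter G (hP.disjoint_TQ hQ), ← ncard_edgesBetween G (hP.disjoint_TQ hQ)]
  refine Set.ncard_lt_ncard ⟨Set.inter_subset_left, fun h ↦ ?_⟩
    ((Set.toFinite G.edgeSet).subset ?_)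
  · exact he.notMem_edgeSet hV hK hd (h heQ).2
  · rintro f ⟨x, -, y, -, hl⟩
    exact hl.edge_mem

/-- The degree equations for `G` and for the factor `K` express `(2r+1)t` and `2kt` as sums over
components of `a - b` and `aK - bK`. Parity forces `aK - bK ≤ 0` on blisters and `aK ≤ 2` where `a =
3`; where a cut-edge arrives, `aK < a`. -/
theorem IsPartition.not_hasFactor [Finite G.edgeSet] (hP : G.IsPartition R S T)
    (hV : G.vertexSet.Finite) {r k : ℕ} (hk : 3 * k ≤ 2 * r + 1)
    (hreg : G.IsRegular (2 * r + 1)) (hS : G.IsIndependent S) (hT : G.IsIndependent T)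
    (hSedge : ∀ e, ∀ s ∈ S, ∀ x, G.IsLink e s x →
      x ∈ T ∨ ∃ Q, (G.induce R).IsComponent Q ∧ x ∈ Q ∧ G.IsBlister (2 * r + 1) S T Q)
    (hthree : ({Q | (G.induce R).IsComponent Q ∧ (G.edgesBetween T Q).ncard = 3}.ncard : ℤ) =
      k * ((T.ncard : ℤ) - S.ncard) - 1)
    (hrest : ∀ Q, (G.induce R).IsComponent Q →
      (∀ e ∈ G.edgesBetween T Q, ¬ G.IsCutEdge e) → ¬ G.IsBlister (2 * r + 1) S T Q →
      (G.edgesBetween T Q).ncard ≠ 3 → (G.induce Q).IsRegular (2 * r + 1))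
    (hstrict : 3 * k < 2 * r + 1 → (T.ncard : ℤ) - S.ncard = 1) :
    ¬ G.HasFactor (2 * k) := by
  classical
  rintro ⟨K, hKs, hKreg⟩
  have hK : K ≤ G := hKs.le
  have hKd : ∀ v ∈ G.vertexSet, K.degree v = 2 * k := fun v hv ↦
    hKreg v (hKs.vertexSet_eq ▸ hv)
  have hR := hV.subset hP.subset_R
  have hRT := Set.disjoint_left.1 hP.disjoint_RT
  set 𝒬 := (finite_setOf_isComponent (G := G) hR).toFinset with h𝒬
  have hmem : ∀ Q, Q ∈ 𝒬 ↔ (G.induce R).IsComponent Q := by simp [h𝒬]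
  set a : Set α → ℕ := fun Q ↦ G.hc Set.univ T Q with ha
  set b : Set α → ℕ := fun Q ↦ G.hc Set.univ S Q with hb
  set aK : Set α → ℕ := fun Q ↦ G.hc K.edgeSet T Q with haK
  set bK : Set α → ℕ := fun Q ↦ G.hc K.edgeSet S Q with hbK
  have haE : ∀ Q, (G.induce R).IsComponent Q → (G.edgesBetween T Q).ncard = a Q := fun Q hQ ↦
    ncard_edgesBetween G (hP.disjoint_TQ hQ)
  have hbE : ∀ Q, (G.induce R).IsComponent Q → (G.edgesBetween S Q).ncard = b Q := fun Q hQ ↦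
    ncard_edgesBetween G (hP.disjoint_SQ hQ)
  have haKle : ∀ Q, aK Q ≤ a Q := fun Q ↦ hc_mono G (Set.subset_univ _) subset_rfl subset_rfl
  have hbKle : ∀ Q, bK Q ≤ b Q := fun Q ↦ hc_mono G (Set.subset_univ _) subset_rfl subset_rfl
  have hpar : ∀ Q, (G.induce R).IsComponent Q → Even (bK Q + aK Q) := fun Q hQ ↦
    hP.even_hc_add hV hK hKd hQ
  have hblister : ∀ Q, (G.induce R).IsComponent Q → G.IsBlister (2 * r + 1) S T Q →
      a Q = 1 ∧ b Q = 1 := by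
    rintro Q hQ ⟨e₁, e₂, s, t, u, v, h1, -, -, -, h2, -⟩
    rw [← haE Q hQ, ← hbE Q hQ, h1, h2, Set.ncard_singleton, Set.ncard_singleton]
    exact ⟨rfl, rfl⟩
  have hblister' : ∀ Q, (G.induce R).IsComponent Q → ¬ G.IsBlister (2 * r + 1) S T Q →
      b Q = 0 := by
    intro Q hQ hnb
    rw [hb, hc_eq_zero_iff]
    intro e _ s hs x hx hl
    rcases hSedge e s hs x hl with hxT | ⟨Q', hQ', hxQ', hbl⟩
    · exact hRT (hQ.subset hx) hxT
    · rw [hQ'.eq_of_mem hQ hxQ' hx] at hbl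
      exact hnb hbl
  have hba : ∀ Q, (G.induce R).IsComponent Q → b Q ≤ a Q := by
    intro Q hQ
    by_cases hbl : G.IsBlister (2 * r + 1) S T Q
    · rw [(hblister Q hQ hbl).1, (hblister Q hQ hbl).2]
    · rw [hblister' Q hQ hbl]
      exact Nat.zero_le _
  have hzero : ∀ Q, (G.induce R).IsComponent Q →
      (∀ e ∈ G.edgesBetween T Q, ¬ G.IsCutEdge e) → ¬ G.IsBlister (2 * r + 1) S T Q →
      a Q ≠ 3 → a Q = 0 := by
    intro Q hQ h1 h2 h3
    exact (hP.hc_eq_zero_of_isRegular_induce hV hreg hQ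
      (hrest Q hQ h1 h2 (by rwa [haE Q hQ]))).2
  have hTT : ∀ F, G.hc F T T = 0 := fun F ↦ by
    rw [hc_eq_zero_iff]
    exact fun f _ x hx y hy hl ↦ hT x hx y hy ⟨f, hl⟩
  have hSS : ∀ F, G.hc F S S = 0 := fun F ↦ by
    rw [hc_eq_zero_iff]
    exact fun f _ x hx y hy hl ↦ hS x hx y hy ⟨f, hl⟩
  have hN : {Q | (G.induce R).IsComponent Q ∧ (G.edgesBetween T Q).ncard = 3}.ncard =
      ∑ Q ∈ 𝒬, if a Q = 3 then 1 else 0 := by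
    rw [← Finset.card_filter, ← Set.ncard_coe_finset]
    congr 1
    ext Q
    simp only [Set.mem_ofPred_eq, Finset.coe_filter, hmem]
    exact and_congr_right fun hQ ↦ by rw [haE Q hQ]
  rw [hN] at hthree
  have hKsum := hP.degree_sum hV hK hKd
  rw [hTT, hSS, hc_components hR, hc_components hR] at hKsum
  have hsum := hP.degree_sum hV le_rfl hreg
  rw [hc_edgeSet, hc_edgeSet, hc_edgeSet, hc_edgeSet, hTT, hSS, hc_components hR,
    hc_components hR] at hsum
  set t : ℤ := (T.ncard : ℤ) - S.ncard with ht
  push_cast at hKsum hsum hthree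
  replace hKsum : 2 * (k : ℤ) * t = ∑ Q ∈ 𝒬, ((aK Q : ℤ) - bK Q) := by
    rw [Finset.sum_sub_distrib]; linarith
  replace hsum : (2 * (r : ℤ) + 1) * t = ∑ Q ∈ 𝒬, ((a Q : ℤ) - b Q) := by
    rw [Finset.sum_sub_distrib]; linarith
  rcases hk.lt_or_eq with hlt | heq
  · have ht1 := hstrict hlt
    have hcard : T.ncard = S.ncard + 1 := by omega
    -- As `t = 1`, a non-blister reached by a cut-edge has `a ≤ 1`, so `aK = 0`. Only the `k - 1`
    -- components with `a = 3` can contribute, and the sum `2 * k` would be at most `2 * (k - 1)`.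
    have hle : ∑ Q ∈ 𝒬, ((aK Q : ℤ) - bK Q) ≤ ∑ Q ∈ 𝒬, 2 * (if a Q = 3 then (1 : ℤ) else 0) := by
      refine Finset.sum_le_sum fun Q hQ ↦ ?_
      rw [hmem] at hQ
      have h1 := haKle Q
      have h2 := hbKle Q
      have h3 := hpar Q hQ
      rw [Nat.even_iff] at h3
      by_cases hbl : G.IsBlister (2 * r + 1) S T Q
      · obtain ⟨h4, h5⟩ := hblister Q hQ hbl
        split_ifs <;> omega
      · have h4 := hblister' Q hQ hbl
        by_cases hcut : ∃ e ∈ G.edgesBetween T Q, G.IsCutEdge e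
        · obtain ⟨e, heQ, he⟩ := hcut
          have h5 := hP.hc_lt_of_isCutEdge hV hK hKd hQ he heQ
          have h6 := hP.hc_le_of_isCutEdge hV hreg (by omega) hS hT hcard hba hQ he heQ
          change aK Q < a Q at h5
          change a Q ≤ b Q + 1 at h6
          split_ifs <;> omega
        · push Not at hcut
          by_cases h3 : a Q = 3
          · rw [if_pos h3]; omega
          · have h5 := hzero Q hQ hcut hbl h3
            rw [if_neg h3]; omega
    rw [← Finset.mul_sum, hthree, ← hKsum, ht1] at hle
    linarith
  -- Here `2r+1 = 3k` and `t` is arbitrary, so cut-edge components may have larger `a`; `c` marks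
  -- those that are neither blisters nor have `a = 3`. The equation for `G` makes their `a` sum to
  -- 3, and that for `K` allows at most one of them. It would then have `a = 3`, which is excluded.
  · set c : Set α → ℤ := fun Q ↦
      if (∃ e ∈ G.edgesBetween T Q, G.IsCutEdge e) ∧ a Q ≠ 3 ∧ ¬ G.IsBlister (2 * r + 1) S T Q
      then 1 else 0 with hc
    have h1 : ∑ Q ∈ 𝒬, ((a Q : ℤ) - b Q) =
        ∑ Q ∈ 𝒬, (3 * (if a Q = 3 then (1 : ℤ) else 0) + a Q * c Q) := by
      refine Finset.sum_congr rfl fun Q hQ ↦ ?_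
      rw [hmem] at hQ
      by_cases hbl : G.IsBlister (2 * r + 1) S T Q
      · obtain ⟨h4, h5⟩ := hblister Q hQ hbl
        simp [hc, hbl, h4, h5]
      · have h4 := hblister' Q hQ hbl
        by_cases h3 : a Q = 3
        · simp [hc, h3, h4]
        · by_cases hcut : ∃ e ∈ G.edgesBetween T Q, G.IsCutEdge e
          · simp [hc, hcut, h3, h4, hbl]
          · have : a Q = 0 := hzero Q hQ (by push Not at hcut; exact hcut) hbl h3
            simp [hc, this, h4]
    have h2 : ∑ Q ∈ 𝒬, ((aK Q : ℤ) - bK Q) ≤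
        ∑ Q ∈ 𝒬, (2 * (if a Q = 3 then (1 : ℤ) else 0) + (a Q * c Q - c Q)) := by
      refine Finset.sum_le_sum fun Q hQ ↦ ?_
      rw [hmem] at hQ
      have h1 := haKle Q
      have h2 := hbKle Q
      have h3 := hpar Q hQ
      rw [Nat.even_iff] at h3
      by_cases hbl : G.IsBlister (2 * r + 1) S T Q
      · obtain ⟨h4, h5⟩ := hblister Q hQ hbl
        simp only [hc, hbl, h4]
        norm_num
        omega
      · have h4 := hblister' Q hQ hbl
        by_cases h3 : a Q = 3
        · simp only [hc, h3]
          norm_num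
          omega
        · by_cases hcut : ∃ e ∈ G.edgesBetween T Q, G.IsCutEdge e
          · obtain ⟨e, heQ, he⟩ := hcut
            have h5 : aK Q < a Q := hP.hc_lt_of_isCutEdge hV hK hKd hQ he heQ
            have h6 : c Q = 1 := if_pos ⟨⟨e, heQ, he⟩, h3, hbl⟩
            rw [h6, if_neg h3]
            omega
          · have h5 : a Q = 0 := hzero Q hQ (by push Not at hcut; exact hcut) hbl h3
            have h6 : c Q = 0 := if_neg fun h ↦ hcut h.1
            rw [h6, if_neg h3]
            omega
    rw [Finset.sum_add_distrib, ← Finset.mul_sum, hthree] at h1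
    rw [Finset.sum_add_distrib, ← Finset.mul_sum, hthree, ← hKsum, Finset.sum_sub_distrib] at h2
    rw [← hsum] at h1
    have heq' : (2 * (r : ℤ) + 1) = 3 * k := by exact_mod_cast heq.symm
    rw [heq'] at h1
    have hac : ∑ Q ∈ 𝒬, (a Q : ℤ) * c Q = 3 := by linarith
    have hcle : ∑ Q ∈ 𝒬, c Q ≤ 1 := by linarith
    have hcsum : ∑ Q ∈ 𝒬, c Q = (𝒬.filter fun Q ↦ (∃ e ∈ G.edgesBetween T Q, G.IsCutEdge e) ∧
        a Q ≠ 3 ∧ ¬ G.IsBlister (2 * r + 1) S T Q).card := by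
      simp [hc, Finset.sum_boole]
    have hacsum : ∑ Q ∈ 𝒬, (a Q : ℤ) * c Q = ∑ Q ∈ 𝒬.filter fun Q ↦
        (∃ e ∈ G.edgesBetween T Q, G.IsCutEdge e) ∧
        a Q ≠ 3 ∧ ¬ G.IsBlister (2 * r + 1) S T Q, (a Q : ℤ) := by
      rw [Finset.sum_filter]
      exact Finset.sum_congr rfl fun Q _ ↦ by simp only [hc, mul_ite, mul_one, mul_zero]
    rw [hcsum] at hcle
    rw [hacsum] at hac
    have hcle' : (𝒬.filter fun Q ↦ (∃ e ∈ G.edgesBetween T Q, G.IsCutEdge e) ∧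
        a Q ≠ 3 ∧ ¬ G.IsBlister (2 * r + 1) S T Q).card ≤ 1 := by exact_mod_cast hcle
    rcases Finset.card_le_one_iff_subset_singleton.1 hcle' with ⟨Q, hQ⟩
    rcases Finset.subset_singleton_iff.1 hQ with h | h
    · rw [h] at hac; simp at hac
    · rw [h, Finset.sum_singleton] at hac
      have : Q ∈ ({Q} : Finset (Set α)) := Finset.mem_singleton_self Q
      rw [← h] at this
      exact (Finset.mem_filter.1 this).2.2.1 (by exact_mod_cast hac)

end Graph

/-! ### The factor theorem for multigraphs -/

namespace Graph

open HalfEdge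

variable {α β : Type*} {G : Graph α β} {R S T Q : Set α} {d : ℕ}

theorem hc_eq_card_filter [Fintype G.edgeSet] (F : Set β) (A B : Set α)
    [DecidablePred fun h : G.edgeSet × Bool ↦
      h.1.1 ∈ F ∧ G.src h ∈ A ∧ G.src (opp h) ∈ B] :
    G.hc F A B = (Finset.univ.filter fun h : G.edgeSet × Bool ↦
      h.1.1 ∈ F ∧ G.src h ∈ A ∧ G.src (opp h) ∈ B).card := by
  rw [hc, ← Set.ncard_coe_finset]
  congr 1
  ext h
  simp [halfEdges]

/-- As `2 * k` is even, the vertex terms do not affect which classes are odd, and only the parity of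
the edges from `T` remains. -/
theorem hasFactor_or_barrier [Finite G.edgeSet] (hV : G.vertexSet.Finite) {k : ℕ}
    (hd : ∀ v ∈ G.vertexSet, 2 * k < G.degree v) :
    G.HasFactor (2 * k) ∨ ∃ (R S T : Set α) (hR : R.Finite), G.IsPartition R S T ∧
      2 * k * S.ncard + G.hc Set.univ T Set.univ < 2 * k * T.ncard + G.hc Set.univ T S +
        ∑ Q ∈ (finite_setOf_isComponent (G := G) hR).toFinset, G.hc Set.univ T Q % 2 := by
  classical
  have := Fintype.ofFinite G.edgeSet
  have := hV.fintype
  set p : G.edgeSet × Bool → G.vertexSet := fun h ↦ ⟨G.src h, G.src_mem h⟩ with hp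
  have hdeg : ∀ v : G.vertexSet, 2 * k < (Finset.univ.filter fun h ↦ p h = v).card := by
    rintro ⟨v, hv⟩
    have h1 := hd v hv
    rw [degree_eq_hc G le_rfl, hc_eq_card_filter] at h1
    convert h1 using 4 with h
    simp [hp, Subtype.ext_iff]
  rcases exists_factor_or_barrier p (fun _ ↦ 2 * k) hdeg with
    ⟨F, hF⟩ | ⟨S, T, ι, _, _, C, hST, hC, hcard⟩
  · left
    have hle : G.restrict (Subtype.val '' (F : Set G.edgeSet)) ≤ G := restrict_le
    refine ⟨G.restrict (Subtype.val '' (F : Set G.edgeSet)), ⟨hle, rfl⟩, ?_⟩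
    intro v hv
    rw [degree_eq_hc G hle, hc_eq_card_filter, ← hF ⟨v, hv⟩]
    congr 1
    ext h
    simp [hp, Subtype.ext_iff]
  right
  set S' : Set α := Subtype.val '' (S : Set G.vertexSet) with hS'
  set T' : Set α := Subtype.val '' (T : Set G.vertexSet) with hT'
  have hSmem : ∀ v : G.vertexSet, v.1 ∈ S' ↔ v ∈ S := fun v ↦ by simp [hS']
  have hTmem : ∀ v : G.vertexSet, v.1 ∈ T' ↔ v ∈ T := fun v ↦ by simp [hT']
  have hSV : S' ⊆ G.vertexSet := by rintro _ ⟨v, -, rfl⟩; exact v.2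
  have hTV : T' ⊆ G.vertexSet := by rintro _ ⟨v, -, rfl⟩; exact v.2
  set R : Set α := G.vertexSet \ (S' ∪ T') with hR'
  have hR : R.Finite := hV.subset Set.sdiff_subset
  have hRmem : ∀ v : G.vertexSet, v.1 ∈ R ↔ v ∉ S ∧ v ∉ T := fun v ↦ by
    rw [hR', Set.mem_sdiff, Set.mem_union, hSmem, hTmem]
    simp
  have hSTd : Disjoint S' T' := by
    rw [Set.disjoint_left]
    rintro _ ⟨v, hv, rfl⟩ hvT
    exact (Finset.disjoint_left.1 hST) hv ((hTmem v).1 hvT)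
  refine ⟨R, S', T', hR, ⟨?_, ?_, ?_, hSTd⟩, ?_⟩
  · rw [Set.union_assoc, hR', Set.sdiff_union_self, Set.union_eq_left]
    exact Set.union_subset hSV hTV
  · exact Set.disjoint_left.2 fun x hx hx' ↦ hx.2 (.inl hx')
  · exact Set.disjoint_left.2 fun x hx hx' ↦ hx.2 (.inr hx')
  have hScard : S'.ncard = S.card := by
    rw [hS', Set.ncard_image_of_injective _ Subtype.val_injective, Set.ncard_coe_finset]
  have hTcard : T'.ncard = T.card := by
    rw [hT', Set.ncard_image_of_injective _ Subtype.val_injective, Set.ncard_coe_finset]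
  have h1 : G.hc Set.univ T' Set.univ = (Finset.univ.filter fun h ↦ p h ∈ T).card := by
    rw [hc_eq_card_filter]
    congr 1
    ext h
    simp [← hTmem, hp]
  have h2 : G.hc Set.univ T' S' =
      (Finset.univ.filter fun h ↦ p h ∈ T ∧ p (opp h) ∈ S).card := by
    rw [hc_eq_card_filter]
    congr 1
    ext h
    simp [← hTmem, ← hSmem, hp]
  set X : ι → Set α := fun i ↦ {v | ∃ hv : v ∈ G.vertexSet, C ⟨v, hv⟩ = i} with hX
  have h3 : ∀ i, G.hc Set.univ T' (R ∩ X i) = (Finset.univ.filter fun h ↦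
      p h ∈ T ∧ (p (opp h) ∉ S ∧ p (opp h) ∉ T) ∧ C (p (opp h)) = i).card := by
    intro i
    rw [hc_eq_card_filter]
    congr 1
    ext h
    simp only [Finset.mem_filter, Finset.mem_univ, true_and, hX, Set.mem_univ, Set.mem_inter_iff,
      Set.mem_ofPred_eq]
    refine and_congr (hTmem (p h)) (and_congr (hRmem (p (opp h))) ?_)
    exact ⟨fun ⟨_, h⟩ ↦ h, fun h' ↦ ⟨G.src_mem _, h'⟩⟩
  have hclosed : ∀ i e a b, G.IsLink e a b → a ∈ R → b ∈ R → a ∈ X i → b ∈ X i := by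
    rintro i e a b hl ha hb ⟨hv, hCa⟩
    obtain ⟨h, -, rfl, rfl⟩ := hl.exists_src
    refine ⟨G.src_mem _, ?_⟩
    rw [← hCa]
    have ha' := (hRmem (p h)).1 ha
    have hb' := (hRmem (p (opp h))).1 hb
    exact (hC h ha'.1 ha'.2 hb'.1 hb'.2).symm
  rw [hScard, hTcard, h1, h2]
  simp only [Finset.sum_const, smul_eq_mul] at hcard
  set 𝒬 := (finite_setOf_isComponent (G := G) hR).toFinset with h𝒬
  have hmem : ∀ Q, Q ∈ 𝒬 ↔ (G.induce R).IsComponent Q := by simp [h𝒬]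
  -- A class is a union of components, so an odd class contains an odd component; distinct classes
  -- are disjoint and give distinct components.
  have hodd : (Finset.univ.filter fun i ↦ Odd (G.hc Set.univ T' (R ∩ X i))).card ≤
      (𝒬.filter fun Q ↦ Odd (G.hc Set.univ T' Q)).card := by
    have hex : ∀ i, Odd (G.hc Set.univ T' (R ∩ X i)) →
        ∃ Q ∈ 𝒬, Q ⊆ X i ∧ Odd (G.hc Set.univ T' Q) := by
      intro i hi
      rw [hc_components_inter hR _ _ (hclosed i)] at hi
      by_contra hcon
      push Not at hcon
      refine (Nat.not_even_iff_odd.2 hi) (Finset.even_sum _ fun Q hQ ↦ ?_)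
      rw [Finset.mem_filter] at hQ
      exact Nat.not_odd_iff_even.1 (hcon Q hQ.1 hQ.2)
    choose! φ hφ1 hφ2 hφ3 using hex
    refine Finset.card_le_card_of_injOn φ ?_ ?_
    · intro i hi
      simp only [Finset.coe_filter, Finset.mem_univ, true_and, Set.mem_ofPred_eq] at hi ⊢
      exact ⟨hφ1 i hi, hφ3 i hi⟩
    · intro i hi j hj hij
      simp only [Finset.coe_filter, Finset.mem_univ, true_and, Set.mem_ofPred_eq] at hi hj
      obtain ⟨x, hx⟩ := IsComponent.nonempty ((hmem _).1 (hφ1 i hi))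
      obtain ⟨_, h1⟩ := hφ2 i hi hx
      rw [hij] at hx
      obtain ⟨_, h2⟩ := hφ2 j hj hx
      rw [← h1, ← h2]
  have hsum : ∑ Q ∈ 𝒬, G.hc Set.univ T' Q % 2 =
      (𝒬.filter fun Q ↦ Odd (G.hc Set.univ T' Q)).card := by
    rw [Finset.card_filter]
    refine Finset.sum_congr rfl fun Q _ ↦ ?_
    split_ifs with hQ <;> rw [Nat.odd_iff] at hQ <;> omega
  have hi : ∀ i, Odd ((Finset.univ.filter fun v ↦ (v ∉ S ∧ v ∉ T) ∧ C v = i).card * (2 * k) +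
      (Finset.univ.filter fun h ↦
        p h ∈ T ∧ (p (opp h) ∉ S ∧ p (opp h) ∉ T) ∧ C (p (opp h)) = i).card) ↔
      Odd (G.hc Set.univ T' (R ∩ X i)) := by
    intro i
    rw [h3, Nat.odd_add']
    refine ⟨fun h ↦ h.2 ?_, fun h ↦ iff_of_true h ?_⟩ <;> exact (even_two_mul k).mul_left _
  simp only [hi] at hcard
  rw [hsum]
  linarith

end Graph

/-! ### Adding an edge -/

namespace Graph

open HalfEdge

variable {α β : Type*} {G : Graph α β} {R S T Q : Set α} {d : ℕ}

/-- The graph `K` with a further edge `e` joining `u` and `v`. -/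
def addEdge (K : Graph α β) (e : β) (u v : α) (he : e ∉ K.edgeSet) (hu : u ∈ K.vertexSet)
    (hv : v ∈ K.vertexSet) : Graph α β where
  vertexSet := K.vertexSet
  IsLink f x y := K.IsLink f x y ∨ f = e ∧ (x = u ∧ y = v ∨ x = v ∧ y = u)
  isLink_symm f _ := ⟨fun x y h ↦ by
    rcases h with h | ⟨h1, h2⟩
    · exact .inl h.symm
    · exact .inr ⟨h1, by tauto⟩⟩
  eq_or_eq_of_isLink_of_isLink f x y z w h h' := by
    rcases h with h | ⟨h1, h2⟩ <;> rcases h' with h' | ⟨h1', h2'⟩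
    · exact h.left_eq_or_eq h'
    · exact (he (h1' ▸ h.edge_mem)).elim
    · exact (he (h1 ▸ h'.edge_mem)).elim
    · rcases h2 with ⟨rfl, rfl⟩ | ⟨rfl, rfl⟩ <;> rcases h2' with ⟨rfl, rfl⟩ | ⟨rfl, rfl⟩ <;> simp
  left_mem_of_isLink f x y h := by
    rcases h with h | ⟨-, ⟨rfl, -⟩ | ⟨rfl, -⟩⟩
    · exact h.left_mem
    · exact hu
    · exact hv

section

variable {K : Graph α β} {e : β} {u v : α} (he : e ∉ K.edgeSet) (hu : u ∈ K.vertexSet)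
  (hv : v ∈ K.vertexSet)

theorem addEdge_isLink {f : β} {x y : α} : (K.addEdge e u v he hu hv).IsLink f x y ↔
    K.IsLink f x y ∨ f = e ∧ (x = u ∧ y = v ∨ x = v ∧ y = u) := Iff.rfl

theorem deleteEdges_addEdge : (K.addEdge e u v he hu hv).deleteEdges {e} = K := by
  refine Graph.ext rfl fun f x y ↦ ?_
  rw [deleteEdges_isLink, addEdge_isLink, Set.mem_singleton_iff]
  constructor
  · rintro ⟨h | h, hf⟩
    · exact h
    · exact (hf h.1).elim
  · intro h
    exact ⟨.inl h, fun hf ↦ he (hf ▸ h.edge_mem)⟩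

open Classical in
theorem degree_addEdge [Finite K.edgeSet] (w : α) : (K.addEdge e u v he hu hv).degree w =
    K.degree w + (if w = u then 1 else 0) + (if w = v then 1 else 0) := by
  rw [degree_def, degree_def]
  have hl : (K.addEdge e u v he hu hv).loopSet w =
      if w = u ∧ w = v then insert e (K.loopSet w) else K.loopSet w := by
    ext f
    rw [mem_loopSet, IsLoopAt, addEdge_isLink]
    split_ifs with h
    · obtain ⟨rfl, rfl⟩ := h
      simp [← isLink_self_iff, or_comm]
    · rw [mem_loopSet, ← isLink_self_iff]
      tauto
  have hn : {f | (K.addEdge e u v he hu hv).IsNonloopAt f w} =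
      if u ≠ v ∧ (w = u ∨ w = v) then insert e {f | K.IsNonloopAt f w}
      else {f | K.IsNonloopAt f w} := by
    ext f
    simp only [Set.mem_ofPred_eq, IsNonloopAt, addEdge_isLink]
    split_ifs with h
    · rw [Set.mem_insert_iff]
      constructor
      · rintro ⟨y, hy, hyl | hyl⟩
        · exact .inr ⟨y, hy, hyl⟩
        · exact .inl hyl.1
      · rintro (rfl | ⟨y, hy, hyl⟩)
        · obtain ⟨huv, rfl | rfl⟩ := h
          · exact ⟨v, huv.symm, .inr ⟨rfl, .inl ⟨rfl, rfl⟩⟩⟩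
          · exact ⟨u, huv, .inr ⟨rfl, .inr ⟨rfl, rfl⟩⟩⟩
        · exact ⟨y, hy, .inl hyl⟩
    · constructor
      · rintro ⟨y, hy, hyl | ⟨rfl, ⟨rfl, rfl⟩ | ⟨rfl, rfl⟩⟩⟩
        · exact ⟨y, hy, hyl⟩
        · exact (h ⟨hy.symm, .inl rfl⟩).elim
        · exact (h ⟨hy, .inr rfl⟩).elim
      · rintro ⟨y, hy, hyl⟩
        exact ⟨y, hy, .inl hyl⟩
  have hfl : (K.loopSet w).Finite :=
    (Set.toFinite K.edgeSet).subset fun f hf ↦ IsLoopAt.edge_mem hf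
  have hfn : {f | K.IsNonloopAt f w}.Finite :=
    (Set.toFinite K.edgeSet).subset fun f hf ↦ IsNonloopAt.edge_mem hf
  have h1 : (insert e (K.loopSet w)).ncard = (K.loopSet w).ncard + 1 :=
    Set.ncard_insert_of_notMem (fun h ↦ he (IsLoopAt.edge_mem h)) hfl
  have h2 : (insert e {f | K.IsNonloopAt f w}).ncard = {f | K.IsNonloopAt f w}.ncard + 1 :=
    Set.ncard_insert_of_notMem (fun h ↦ he (IsNonloopAt.edge_mem h)) hfn
  rw [hl, hn]
  by_cases huv : u = v
  · subst huv
    by_cases hw : w = u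
    · simp only [hw, and_self, if_true, ne_eq, not_true_eq_false, false_and, if_false]
      rw [hw] at h1
      rw [h1]
      ring
    · simp [hw]
  · by_cases hw : w = u
    · subst hw
      simp only [huv, and_false, if_false, ne_eq, not_false_eq_true, true_or, and_self, if_true, h2]
      ring
    · by_cases hw' : w = v
      · subst hw'
        simp only [hw, false_and, if_false, ne_eq, huv, not_false_eq_true, or_true, and_self,
          if_true, h2]
        ring
      · simp [hw, hw']

end

/-! ### Components with few edges to `S` and `T` -/

theorem IsPartition.mem_of_isLink (hP : G.IsPartition R S T)
    (hQ : (G.induce R).IsComponent Q) {e : β} {x y : α} (hl : G.IsLink e x y) (hx : x ∈ Q) :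
    y ∈ Q ∨ y ∈ S ∧ e ∈ G.edgesBetween S Q ∨ y ∈ T ∧ e ∈ G.edgesBetween T Q := by
  rcases hP.cases hl.right_mem with hy | hy | hy
  · exact .inl (hQ.mem_of_isLink hl hx hy)
  · exact .inr (.inl ⟨hy, y, hy, x, hx, hl.symm⟩)
  · exact .inr (.inr ⟨hy, y, hy, x, hx, hl.symm⟩)

theorem IsPartition.isCutEdge_of_edgesBetween (hP : G.IsPartition R S T)
    (hQ : (G.induce R).IsComponent Q) (hS : G.edgesBetween S Q = ∅) {e : β}
    (hT : G.edgesBetween T Q = {e}) : G.IsCutEdge e := by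
  have : e ∈ G.edgesBetween T Q := hT ▸ rfl
  obtain ⟨t, ht, q, hq, hl⟩ := this
  refine isCutEdge_iff.2 ⟨Q, q, t, hl.symm, hq, Set.disjoint_left.1 (hP.disjoint_TQ hQ) ht, ?_⟩
  intro f a b hf ha hb
  rcases hP.mem_of_isLink hQ hf ha with h | h | h
  · exact (hb h).elim
  · rw [hS] at h
    exact h.2.elim
  · rw [hT] at h
    exact h.2

theorem degree_induce_add [Finite G.edgeSet] (hP : G.IsPartition R S T)
    (hQ : (G.induce R).IsComponent Q) {w : α} (hw : w ∈ Q) :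
    G.degree w = (G.induce Q).degree w + (G.edgesBetween S {w}).ncard +
      (G.edgesBetween T {w}).ncard := by
  have hQV : Q ⊆ G.vertexSet := hQ.subset.trans hP.subset_R
  rw [degree_eq_hc G le_rfl, hc_edgeSet, degree_eq_hc G (induce_le hQV), hP.hc_univ,
    hc_comm G _ _ S, hc_comm G _ _ T, ncard_edgesBetween, ncard_edgesBetween]
  · congr 2
    rw [hc, hc]
    congr 1
    ext h
    constructor
    · rintro ⟨-, h1, h2⟩
      rw [Set.mem_singleton_iff] at h1
      have hs : G.src h ∈ Q := h1 ▸ hw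
      exact ⟨⟨_, _, G.isLink_src h, hs, hQ.mem_of_isLink (G.isLink_src h) hs h2⟩, h1, trivial⟩
    · rintro ⟨⟨x, y, hl, hx, hy⟩, h1, -⟩
      refine ⟨trivial, h1, hQ.subset ?_⟩
      rcases (G.isLink_src h).right_eq_or_eq hl with h' | h' <;> rw [h'] <;> assumption
  · exact (hP.disjoint_TQ hQ).mono_right (Set.singleton_subset_iff.2 hw)
  · exact (hP.disjoint_SQ hQ).mono_right (Set.singleton_subset_iff.2 hw)

theorem edgesBetween_eq_empty_of_subset {A B B' : Set α} (h : G.edgesBetween A B' = ∅)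
    (hB : B ⊆ B') : G.edgesBetween A B = ∅ := by
  rw [Set.eq_empty_iff_forall_notMem] at h ⊢
  rintro e ⟨x, hx, y, hy, hl⟩
  exact h e ⟨x, hx, y, hB hy, hl⟩

theorem IsPartition.isRegular_induce [Finite G.edgeSet] (hP : G.IsPartition R S T)
    (hd : G.IsRegular d) (hQ : (G.induce R).IsComponent Q) (hS : G.edgesBetween S Q = ∅)
    (hT : G.edgesBetween T Q = ∅) : (G.induce Q).IsRegular d := by
  intro w hw
  have hw' : w ∈ Q := hw
  have := degree_induce_add hP hQ hw'
  rw [hd w (hP.subset_R (hQ.subset hw')),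
    edgesBetween_eq_empty_of_subset hS (Set.singleton_subset_iff.2 hw'),
    edgesBetween_eq_empty_of_subset hT (Set.singleton_subset_iff.2 hw'), Set.ncard_empty] at this
  omega

/-- A set inside the component `Q` that only `f` leaves shows that `f` is a cut-edge; this is
excluded when all cut-edges join `T` to `R`. -/
theorem IsPartition.false_of_separating (hP : G.IsPartition R S T)
    (hcut : ∀ e, G.IsCutEdge e → e ∈ G.edgesBetween T R) (hQ : (G.induce R).IsComponent Q)
    {f : β} {x y : α} (hl : G.IsLink f x y) {Y : Set α} (hYQ : Y ⊆ Q) (hx : x ∈ Y) (hyQ : y ∈ Q)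
    (hy : y ∉ Y) (hY : ∀ g a b, G.IsLink g a b → a ∈ Y → b ∈ Q → b ∉ Y → g = f)
    (hYS : ∀ g a b, G.IsLink g a b → a ∈ Y → b ∈ Q) : False := by
  have : G.IsCutEdge f := isCutEdge_iff.2
    ⟨Y, x, y, hl, hx, hy, fun g a b hg ha hb ↦ hY g a b hg ha (hYS g a b hg ha) hb⟩
  obtain ⟨t, ht, q, hq, htq⟩ := hcut f this
  have hTQ := Set.disjoint_left.1 (hP.disjoint_TQ hQ)
  rcases htq.left_eq_or_eq hl with rfl | rfl
  · exact hTQ ht (hYQ hx)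
  · exact hTQ ht hyQ

theorem IsPartition.not_isCutEdge_induce (hP : G.IsPartition R S T)
    (hcut : ∀ e, G.IsCutEdge e → e ∈ G.edgesBetween T R) (hQ : (G.induce R).IsComponent Q)
    (hS : G.edgesBetween S Q = ∅) (hT : G.edgesBetween T Q = ∅) (f : β) :
    ¬ (G.induce Q).IsCutEdge f := by
  intro hf
  obtain ⟨X, x, y, ⟨hl, hxQ, hyQ⟩, hx, hy, hX⟩ := isCutEdge_iff.1 hf
  refine hP.false_of_separating hcut hQ hl (Y := X ∩ Q) Set.inter_subset_right ⟨hx, hxQ⟩ hyQ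
    (fun h ↦ hy h.1) ?_ ?_
  · intro g a b hg ha hbQ hb
    exact hX g a b ⟨hg, ha.2, hbQ⟩ ha.1 fun h ↦ hb ⟨h, hbQ⟩
  · intro g a b hg ha
    rcases hP.mem_of_isLink hQ hg ha.2 with h | h | h
    · exact h
    · rw [hS] at h; exact h.2.elim
    · rw [hT] at h; exact h.2.elim

theorem ncard_edgesBetween_singleton {A B : Set α} {e : β} {a b w : α} [Decidable (w = b)]
    (hAB : Disjoint A B) (h : G.edgesBetween A B = {e}) (hl : G.IsLink e a b) (ha : a ∈ A)
    (hb : b ∈ B) (hw : w ∈ B) :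
    (G.edgesBetween A {w}).ncard = if w = b then 1 else 0 := by
  have hsub : ∀ f, f ∈ G.edgesBetween A {w} → f = e := by
    rintro f ⟨x, hx, y, hy, hl⟩
    rw [Set.mem_singleton_iff] at hy
    have : f ∈ G.edgesBetween A B := ⟨x, hx, y, hy ▸ hw, hl⟩
    rwa [h] at this
  split_ifs with hwb
  · subst hwb
    rw [Set.ncard_eq_one]
    exact ⟨e, Set.eq_singleton_iff_unique_mem.2 ⟨⟨a, ha, w, rfl, hl⟩, hsub⟩⟩
  · have : G.edgesBetween A {w} = ∅ := by
      rw [Set.eq_empty_iff_forall_notMem]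
      intro f hf
      have hfe := hsub f hf
      obtain ⟨x, hx, y, rfl, hl'⟩ := hf
      rw [hfe] at hl'
      rcases hl'.eq_and_eq_or_eq_and_eq hl with ⟨rfl, rfl⟩ | ⟨rfl, rfl⟩
      · exact hwb rfl
      · exact (Set.disjoint_left.1 hAB) hx hb
    rw [this, Set.ncard_empty]

/-- Joining `u` and `v` inside `Q` restores the degrees lost with the edges to `S` and `T`. A
cut-edge of the resulting graph would give a cut-edge of `G` inside `Q`. The new edge reuses the
label `e₁`, which is free because `e₁` is not an edge of `G[Q]`. -/
theorem IsPartition.isBlister [Finite G.edgeSet] (hP : G.IsPartition R S T)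
    (hd : G.IsRegular d) (hcut : ∀ e, G.IsCutEdge e → e ∈ G.edgesBetween T R)
    (hQ : (G.induce R).IsComponent Q) (hS : (G.edgesBetween S Q).ncard = 1)
    (hT : (G.edgesBetween T Q).ncard = 1) : G.IsBlister d S T Q := by
  classical
  obtain ⟨e₁, h₁⟩ := Set.ncard_eq_one.1 hS
  obtain ⟨e₂, h₂⟩ := Set.ncard_eq_one.1 hT
  have hm₁ : e₁ ∈ G.edgesBetween S Q := h₁ ▸ rfl
  have hm₂ : e₂ ∈ G.edgesBetween T Q := h₂ ▸ rfl
  obtain ⟨s, hs, u, hu, hl₁⟩ := hm₁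
  obtain ⟨t, ht, v, hv, hl₂⟩ := hm₂
  have hSQ := Set.disjoint_left.1 (hP.disjoint_SQ hQ)
  have hTQ := Set.disjoint_left.1 (hP.disjoint_TQ hQ)
  have hQV : Q ⊆ G.vertexSet := hQ.subset.trans hP.subset_R
  have he : e₁ ∉ (G.induce Q).edgeSet := by
    rintro ⟨x, y, hl, hx, hy⟩
    rcases hl₁.left_eq_or_eq hl with rfl | rfl
    · exact hSQ hs hx
    · exact hSQ hs hy
  have hfin : Finite (G.induce Q).edgeSet :=
    ((Set.toFinite G.edgeSet).subset (induce_le hQV).edgeSet_mono).to_subtype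
  have hu' : u ∈ (G.induce Q).vertexSet := hu
  have hv' : v ∈ (G.induce Q).vertexSet := hv
  refine ⟨e₁, e₂, s, t, u, v, h₁, hs, hu, hl₁, h₂, ht, hv, hl₂,
    (G.induce Q).addEdge e₁ u v he hu' hv', e₁, ?_, ?_, .inr ⟨rfl, .inl ⟨rfl, rfl⟩⟩,
    deleteEdges_addEdge he hu' hv'⟩
  · intro w hw
    have hwQ : w ∈ Q := hw
    rw [degree_addEdge, ← hd w (hQV hwQ), degree_induce_add hP hQ hwQ,
      ncard_edgesBetween_singleton (hP.disjoint_SQ hQ) h₁ hl₁ hs hu hwQ,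
      ncard_edgesBetween_singleton (hP.disjoint_TQ hQ) h₂ hl₂ ht hv hwQ]
  · have hout : ∀ Y : Set α, Y ⊆ Q → u ∉ Y → v ∉ Y →
        ∀ g a b, G.IsLink g a b → a ∈ Y → b ∈ Q := by
      intro Y hYQ huY hvY g a b hg ha
      rcases hP.mem_of_isLink hQ hg (hYQ ha) with h | ⟨hbS, h⟩ | ⟨hbT, h⟩
      · exact h
      · rw [h₁] at h
        obtain rfl : g = e₁ := h
        rcases hg.eq_and_eq_or_eq_and_eq hl₁ with ⟨rfl, rfl⟩ | ⟨rfl, rfl⟩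
        · exact (hSQ hs (hYQ ha)).elim
        · exact (huY ha).elim
      · rw [h₂] at h
        obtain rfl : g = e₂ := h
        rcases hg.eq_and_eq_or_eq_and_eq hl₂ with ⟨rfl, rfl⟩ | ⟨rfl, rfl⟩
        · exact (hTQ ht (hYQ ha)).elim
        · exact (hvY ha).elim
    intro f hf
    obtain ⟨X, x, y, hl, hx, hy, hX⟩ := isCutEdge_iff.1 hf
    have hXG : ∀ g a b, G.IsLink g a b → a ∈ Q → b ∈ Q → a ∈ X → b ∉ X → g = f :=
      fun g a b hg ha hb haX hbX ↦ hX g a b (.inl ⟨hg, ha, hb⟩) haX hbX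
    by_cases hfe : f = e₁
    · subst hfe
      have hQX : x ∈ Q → Q ⊆ X := fun hxQ ↦ hQ.subset_of_closed (fun g a b hg ha hb haX ↦ by
        by_contra hbX
        have := hXG g a b hg ha hb haX hbX
        exact he (this ▸ ⟨a, b, hg, ha, hb⟩)) hxQ hx
      have hxQ : x ∈ Q := hl.left_mem
      have hyQ : y ∈ Q := hl.right_mem
      exact hy (hQX hxQ hyQ)
    -- The added edge keeps `u` and `v` on the same side of `f`. The other side has no edges to `S`
    -- or `T`, so `f` separates it in `G` as well.
    · have hl' : (G.induce Q).IsLink f x y := hl.resolve_right fun h ↦ hfe h.1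
      obtain ⟨hlG, hxQ, hyQ⟩ := hl'
      have huv : u ∈ X ↔ v ∈ X := by
        constructor
        · intro hu'
          by_contra hv'
          exact hfe (hX e₁ u v (.inr ⟨rfl, .inl ⟨rfl, rfl⟩⟩) hu' hv').symm
        · intro hv'
          by_contra hu'
          exact hfe (hX e₁ v u (.inr ⟨rfl, .inr ⟨rfl, rfl⟩⟩) hv' hu').symm
      by_cases huX : u ∈ X
      · refine hP.false_of_separating hcut hQ hlG.symm (Y := Q \ X) Set.sdiff_subset ⟨hyQ, hy⟩ hxQ
          (fun h ↦ h.2 hx) ?_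
          (hout _ Set.sdiff_subset (fun h ↦ h.2 huX) fun h ↦ h.2 (huv.1 huX))
        intro g a b hg ha hbQ hb
        exact hXG g b a hg.symm hbQ ha.1 (not_not.1 fun h ↦ hb ⟨hbQ, h⟩) ha.2
      · refine hP.false_of_separating hcut hQ hlG (Y := X ∩ Q) Set.inter_subset_right ⟨hx, hxQ⟩
          hyQ (fun h ↦ hy h.1) ?_
          (hout _ Set.inter_subset_right (fun h ↦ huX h.1) fun h ↦ huX (huv.2 h.1))
        intro g a b hg ha hbQ hb
        exact hXG g a b hg ha.2 hbQ ha.1 fun h ↦ hb ⟨h, hbQ⟩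

end Graph

/-! ### Graphs without a factor -/

namespace Graph

open HalfEdge

variable {α β : Type*} {G : Graph α β} {R S T Q : Set α} {d : ℕ}

/-- The extremal analysis of a barrier in a `d`-regular graph with at most `d + 3 - 3 k` components
that are joined to `T` by one edge and not joined to `S`. -/
theorem barrier_equalities {ι : Type*} (𝒬 : Finset ι) (a b : ι → ℕ) {d k C tt ss : ℕ} {t : ℤ}
    (hk : 3 * k ≤ d) (hC : C = d + 3 - 3 * k) (htt : Even tt)
    (hlt : (∑ Q ∈ 𝒬, (a Q : ℤ)) + tt < 2 * k * t + ∑ Q ∈ 𝒬, ((a Q % 2 : ℕ) : ℤ))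
    (hdeg : (d : ℤ) * t = tt + ∑ Q ∈ 𝒬, (a Q : ℤ) - ss - ∑ Q ∈ 𝒬, (b Q : ℤ))
    (hc : ∑ Q ∈ 𝒬, (if a Q = 1 ∧ b Q = 0 then 1 else 0) ≤ C) :
    0 < t ∧ tt = 0 ∧ ss = 0 ∧ ∑ Q ∈ 𝒬, (if a Q = 1 ∧ b Q = 0 then 1 else 0) = C ∧
      (∀ Q ∈ 𝒬, a Q = 1 ∧ b Q ≤ 1 ∨ a Q = 3 ∧ b Q = 0 ∨ a Q = 0 ∧ b Q = 0) ∧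
      ∑ Q ∈ 𝒬, (if a Q = 3 then (1 : ℤ) else 0) = k * t - 1 ∧ (3 * k < d → t = 1) := by
  obtain ⟨m, rfl⟩ := htt
  -- The slack in `a - b ≤ 3⌊a/2⌋ + [a = 1, b = 0]`. It vanishes exactly for the pairs listed in the
  -- conclusion: even `a ≥ 2` and odd `a ≥ 5` leave a positive remainder.
  set s : ι → ℤ := fun Q ↦
    3 * ((a Q / 2 : ℕ) : ℤ) + ((if a Q = 1 ∧ b Q = 0 then 1 else 0 : ℕ) : ℤ) - a Q + b Q with hs
  have hspos : ∀ Q ∈ 𝒬, 0 ≤ s Q := by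
    intro Q _
    simp only [hs]
    split_ifs <;> omega
  have hszero : ∀ Q, s Q = 0 → a Q = 1 ∧ b Q ≤ 1 ∨ a Q = 3 ∧ b Q = 0 ∨ a Q = 0 ∧ b Q = 0 := by
    intro Q hQ
    simp only [hs] at hQ
    split_ifs at hQ <;> omega
  have hdiv : ∑ Q ∈ 𝒬, (a Q : ℤ) =
      2 * ∑ Q ∈ 𝒬, ((a Q / 2 : ℕ) : ℤ) + ∑ Q ∈ 𝒬, ((a Q % 2 : ℕ) : ℤ) := by
    rw [Finset.mul_sum, ← Finset.sum_add_distrib]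
    exact Finset.sum_congr rfl fun Q _ ↦ by omega
  have hssum : ∑ Q ∈ 𝒬, s Q = 3 * ∑ Q ∈ 𝒬, ((a Q / 2 : ℕ) : ℤ) +
      ((∑ Q ∈ 𝒬, (if a Q = 1 ∧ b Q = 0 then 1 else 0) : ℕ) : ℤ) - ∑ Q ∈ 𝒬, (a Q : ℤ) +
      ∑ Q ∈ 𝒬, (b Q : ℤ) := by
    simp only [hs, Finset.sum_add_distrib, Finset.sum_sub_distrib, Finset.mul_sum, Nat.cast_sum]
  have hs0 := Finset.sum_nonneg hspos
  have hA0 : (0 : ℤ) ≤ ∑ Q ∈ 𝒬, ((a Q / 2 : ℕ) : ℤ) := Finset.sum_nonneg fun _ _ ↦ by positivity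
  set A := ∑ Q ∈ 𝒬, ((a Q / 2 : ℕ) : ℤ) with hA
  set c := ∑ Q ∈ 𝒬, (if a Q = 1 ∧ b Q = 0 then 1 else 0) with hcdef
  have h1 : A + m + 1 ≤ k * t := by
    have : (m : ℤ) + m + 2 * A < 2 * (k * t) := by
      rw [hdiv, Nat.cast_add] at hlt
      set B := ∑ Q ∈ 𝒬, ((a Q % 2 : ℕ) : ℤ)
      linarith
    omega
  have ht : 0 < t := by
    by_contra hcon
    have : (k : ℤ) * t ≤ 0 := mul_nonpos_of_nonneg_of_nonpos (by positivity) (by omega)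
    omega
  -- Eliminating `Σ a - Σ b` and `A` gives `(d - 3k)(t - 1) + m + ss + Σ s + (C - c) ≤ 0`. All five
  -- terms are nonnegative, so each is zero and `A + m + 1 ≤ k * t` is an equality.
  have hprod : 0 ≤ ((d : ℤ) - 3 * k) * (t - 1) := by
    apply mul_nonneg
    · have : (3 * k : ℤ) ≤ d := by exact_mod_cast hk
      linarith
    · linarith
  have hCz : (C : ℤ) = d + 3 - 3 * k := by omega
  have hcz : (c : ℤ) ≤ C := by exact_mod_cast hc
  push_cast at hdeg
  have hexp : ((d : ℤ) - 3 * k) * (t - 1) = d * t - 3 * (k * t) - d + 3 * k := by ring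
  have hm : (m : ℤ) = 0 := by linarith
  have hss : (ss : ℤ) = 0 := by linarith
  have hcC : (c : ℤ) = C := by linarith
  have hsz : ∑ Q ∈ 𝒬, s Q = 0 := by linarith
  have hAk : A = k * t - 1 := by linarith
  have hpz : ((d : ℤ) - 3 * k) * (t - 1) = 0 := by linarith
  have hall : ∀ Q ∈ 𝒬, a Q = 1 ∧ b Q ≤ 1 ∨ a Q = 3 ∧ b Q = 0 ∨ a Q = 0 ∧ b Q = 0 :=
    fun Q hQ ↦ hszero Q ((Finset.sum_eq_zero_iff_of_nonneg hspos).1 hsz Q hQ)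
  refine ⟨ht, by omega, by omega, by exact_mod_cast hcC, hall, ?_, ?_⟩
  · rw [← hAk, hA]
    refine Finset.sum_congr rfl fun Q hQ ↦ ?_
    rcases hall Q hQ with h | h | h <;> simp [h.1]
  · intro hlt
    rcases mul_eq_zero.1 hpz with h | h <;> omega

theorem exists_partition_of_not_hasFactor [Finite G.edgeSet] (hV : G.vertexSet.Finite) {r k : ℕ}
    (hk : 3 * k ≤ 2 * r + 1) (hreg : G.IsRegular (2 * r + 1))
    (hcut : {e | G.IsCutEdge e}.ncard = 2 * r + 4 - 3 * k) (hno : ¬ G.HasFactor (2 * k)) :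
    ∃ R S T : Set α, G.IsPartition R S T ∧
      (G.IsIndependent S ∧ G.IsIndependent T ∧ S.ncard < T.ncard) ∧
      ((∀ e, G.IsCutEdge e → e ∈ G.edgesBetween T R) ∧
        (∀ Q, (G.induce R).IsComponent Q → ∀ e e', G.IsCutEdge e → G.IsCutEdge e' →
          e ∈ G.edgesBetween T Q → e' ∈ G.edgesBetween T Q → e = e')) ∧
      (∀ e, ∀ s ∈ S, ∀ x, G.IsLink e s x →
        x ∈ T ∨ ∃ Q, (G.induce R).IsComponent Q ∧ x ∈ Q ∧ G.IsBlister (2 * r + 1) S T Q) ∧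
      (({Q | (G.induce R).IsComponent Q ∧ (G.edgesBetween T Q).ncard = 3}.ncard : ℤ) =
        k * ((T.ncard : ℤ) - S.ncard) - 1) ∧
      (∀ Q, (G.induce R).IsComponent Q →
        (∀ e ∈ G.edgesBetween T Q, ¬ G.IsCutEdge e) →
        ¬ G.IsBlister (2 * r + 1) S T Q →
        (G.edgesBetween T Q).ncard ≠ 3 →
        (G.induce Q).IsRegular (2 * r + 1) ∧ ∀ e, ¬ (G.induce Q).IsCutEdge e) ∧
      (3 * k < 2 * r + 1 → (T.ncard : ℤ) - S.ncard = 1) := by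
  classical
  obtain ⟨R, S, T, hR, hP, hlt⟩ := (hasFactor_or_barrier hV
    (k := k) fun v hv ↦ by rw [hreg v hv]; omega).resolve_left hno
  have hdeg := hP.degree_sum hV le_rfl hreg
  simp only [hc_edgeSet] at hdeg
  rw [hP.hc_univ, hc_components hR] at hlt
  rw [hc_components hR, hc_components hR] at hdeg
  have hRT := Set.disjoint_left.1 hP.disjoint_RT
  set 𝒬 := (finite_setOf_isComponent (G := G) hR).toFinset with h𝒬
  have hmem : ∀ Q, Q ∈ 𝒬 ↔ (G.induce R).IsComponent Q := by simp [h𝒬]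
  set a : Set α → ℕ := fun Q ↦ G.hc Set.univ T Q with ha
  set b : Set α → ℕ := fun Q ↦ G.hc Set.univ S Q with hb
  have hfinE : ∀ A B : Set α, (G.edgesBetween A B).Finite := fun A B ↦
    (Set.toFinite G.edgeSet).subset fun e ⟨_, _, _, _, hl⟩ ↦ hl.edge_mem
  have haE : ∀ Q, (G.induce R).IsComponent Q → (G.edgesBetween T Q).ncard = a Q := fun Q hQ ↦
    ncard_edgesBetween G (hP.disjoint_TQ hQ)
  have hbE : ∀ Q, (G.induce R).IsComponent Q → (G.edgesBetween S Q).ncard = b Q := fun Q hQ ↦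
    ncard_edgesBetween G (hP.disjoint_SQ hQ)
  have huniq : ∀ Q Q' e, (G.induce R).IsComponent Q → (G.induce R).IsComponent Q' →
      e ∈ G.edgesBetween T Q → e ∈ G.edgesBetween T Q' → Q = Q' := by
    rintro Q Q' e hQ hQ' ⟨t, ht, q, hq, hl⟩ ⟨t', ht', q', hq', hl'⟩
    rcases hl.eq_and_eq_or_eq_and_eq hl' with ⟨rfl, rfl⟩ | ⟨rfl, rfl⟩
    · exact hQ.eq_of_mem hQ' hq hq'
    · exact (hRT (hQ.subset hq) ht').elim
  set 𝒞 := 𝒬.filter fun Q ↦ a Q = 1 ∧ b Q = 0 with h𝒞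
  have hexe : ∀ Q ∈ 𝒞, ∃ e, G.IsCutEdge e ∧ G.edgesBetween T Q = {e} := by
    intro Q hQ
    rw [h𝒞, Finset.mem_filter, hmem] at hQ
    obtain ⟨hQ, h1, h2⟩ := hQ
    rw [← haE Q hQ, Set.ncard_eq_one] at h1
    rw [← hbE Q hQ, Set.ncard_eq_zero (hfinE _ _)] at h2
    obtain ⟨e, he⟩ := h1
    exact ⟨e, hP.isCutEdge_of_edgesBetween hQ h2 he, he⟩
  -- A choice function into `β` needs a default value; `β` is nonempty since `2r + 4 - 3k ≥ 3`
  -- cut-edges exist.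
  rcases isEmpty_or_nonempty β with hβ | hβ
  · have : {e | G.IsCutEdge e} = ∅ := Set.eq_empty_of_isEmpty _
    rw [this, Set.ncard_empty] at hcut
    omega
  choose! φ hφ1 hφ2 using hexe
  have hφinj : Set.InjOn φ 𝒞 := by
    intro Q hQ Q' hQ' hQQ
    have h1 : φ Q ∈ G.edgesBetween T Q := by rw [hφ2 Q hQ]; rfl
    have h2 : φ Q ∈ G.edgesBetween T Q' := by rw [hφ2 Q' hQ', hQQ]; rfl
    rw [Finset.mem_coe, h𝒞, Finset.mem_filter, hmem] at hQ hQ'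
    exact huniq Q Q' _ hQ.1 hQ'.1 h1 h2
  have hcutfin : {e | G.IsCutEdge e}.Finite :=
    (Set.toFinite G.edgeSet).subset fun e ⟨_, _, hl, _⟩ ↦ hl.edge_mem
  have himg : φ '' 𝒞 ⊆ {e | G.IsCutEdge e} := by
    rintro _ ⟨Q, hQ, rfl⟩
    exact hφ1 Q hQ
  have himgcard : (φ '' 𝒞).ncard = ∑ Q ∈ 𝒬, (if a Q = 1 ∧ b Q = 0 then 1 else 0) := by
    rw [hφinj.ncard_image, Set.ncard_coe_finset, h𝒞, Finset.card_filter]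
  have hcle : ∑ Q ∈ 𝒬, (if a Q = 1 ∧ b Q = 0 then 1 else 0) ≤ {e | G.IsCutEdge e}.ncard := by
    rw [← himgcard]
    exact Set.ncard_le_ncard himg hcutfin
  zify at hlt
  obtain ⟨ht, hTT, hSS, hcC, hall, hthree, hstrict⟩ := barrier_equalities 𝒬 a b
    (tt := G.hc Set.univ T T) (ss := G.hc Set.univ S S) (t := (T.ncard : ℤ) - S.ncard)
    hk (hcut.trans (by omega)) (even_hc_self G _ _)
    (by push_cast at hlt ⊢; linarith) (by rw [hdeg]; push_cast; linarith) hcle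
  have hTind : G.IsIndependent T := by
    rw [hc_eq_zero_iff] at hTT
    rintro x hx y hy ⟨e, he⟩
    exact hTT e trivial x hx y hy he
  have hSind : G.IsIndependent S := by
    rw [hc_eq_zero_iff] at hSS
    rintro x hx y hy ⟨e, he⟩
    exact hSS e trivial x hx y hy he
  -- Equality in the count turns the injection from pendant components to cut-edges into a
  -- bijection, which locates every cut-edge of `G`.
  have hsurj : φ '' 𝒞 = {e | G.IsCutEdge e} :=
    Set.eq_of_subset_of_ncard_le himg (by rw [himgcard, hcC]) hcutfin
  have hcutQ : ∀ e, G.IsCutEdge e →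
      ∃ Q, (G.induce R).IsComponent Q ∧ G.edgesBetween T Q = {e} := by
    intro e he
    have : e ∈ φ '' 𝒞 := hsurj ▸ he
    obtain ⟨Q, hQ, rfl⟩ := this
    exact ⟨Q, (hmem Q).1 (Finset.mem_filter.1 hQ).1, hφ2 Q hQ⟩
  have hcutR : ∀ e, G.IsCutEdge e → e ∈ G.edgesBetween T R := by
    intro e he
    obtain ⟨Q, hQ, hQe⟩ := hcutQ e he
    have : e ∈ G.edgesBetween T Q := by rw [hQe]; rfl
    obtain ⟨x, hx, y, hy, hl⟩ := this
    exact ⟨x, hx, y, hQ.subset hy, hl⟩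
  refine ⟨R, S, T, hP, ⟨hSind, hTind, by omega⟩, ⟨hcutR, ?_⟩, ?_, ?_, ?_, hstrict⟩
  · intro Q hQ e e' he _ heQ heQ'
    obtain ⟨Q', hQ', hQe⟩ := hcutQ e he
    have : e ∈ G.edgesBetween T Q' := by rw [hQe]; rfl
    rw [huniq Q Q' e hQ hQ' heQ this, hQe] at heQ'
    exact heQ'.symm
  · intro e s hs x hl
    rcases hP.cases hl.right_mem with hx | hx | hx
    · right
      obtain ⟨Q, hQ, hxQ⟩ := exists_isComponent_mem (G := G.induce R) hx
      refine ⟨Q, hQ, hxQ, ?_⟩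
      -- Among the admissible pairs only `a = b = 1` has an edge to `S`.
      have hb0 : b Q ≠ 0 := fun h0 ↦ by
        rw [hb, hc_eq_zero_iff] at h0
        exact h0 e trivial s hs x hxQ hl
      refine hP.isBlister hreg hcutR hQ ?_ ?_
      · rw [hbE Q hQ]
        rcases hall Q ((hmem Q).2 hQ) with h | h | h <;> omega
      · rw [haE Q hQ]
        rcases hall Q ((hmem Q).2 hQ) with h | h | h <;> omega
    · exact (hSind s hs x hx ⟨e, hl⟩).elim
    · exact .inl hx
  · rw [← hthree, Finset.sum_boole]
    norm_cast
    rw [← Set.ncard_coe_finset]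
    congr 1
    ext Q
    simp only [Set.mem_ofPred_eq, Finset.coe_filter, hmem]
    exact and_congr_right fun hQ ↦ by rw [haE Q hQ]
  · intro Q hQ hnc hnb h3
    rw [haE Q hQ] at h3
    have hzero : a Q = 0 ∧ b Q = 0 := by
      rcases hall Q ((hmem Q).2 hQ) with ⟨h1, h2⟩ | h | h
      · exfalso
        rcases Nat.le_one_iff_eq_zero_or_eq_one.1 h2 with h2 | h2
        · have hQ𝒞 : Q ∈ 𝒞 := Finset.mem_filter.2 ⟨(hmem Q).2 hQ, h1, h2⟩
          exact hnc (φ Q) (by rw [hφ2 Q hQ𝒞]; rfl) (hφ1 Q hQ𝒞)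
        · exact hnb (hP.isBlister hreg hcutR hQ (by rw [hbE Q hQ, h2]) (by rw [haE Q hQ, h1]))
      · exact (h3 h.1).elim
      · exact h
    have h1 : G.edgesBetween T Q = ∅ := by
      rw [← Set.ncard_eq_zero (hfinE _ _), haE Q hQ, hzero.1]
    have h2 : G.edgesBetween S Q = ∅ := by
      rw [← Set.ncard_eq_zero (hfinE _ _), hbE Q hQ, hzero.2]
    exact ⟨hP.isRegular_induce hreg hQ h2 h1, fun e ↦ hP.not_isCutEdge_induce hcutR hQ h2 h1 e⟩

end Graph

theorem theorem3p2 {α β : Type*} (G : Graph α β) (hV : G.vertexSet.Finite) (hE : G.edgeSet.Finite)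
    (r k : ℕ) (hk : 3 * k ≤ 2 * r + 1) (hreg : G.IsRegular (2 * r + 1))
    (hcut : {e | G.IsCutEdge e}.ncard = 2 * r + 4 - 3 * k) :
    ¬ G.HasFactor (2 * k) ↔
      ∃ R S T : Set α, R ∪ S ∪ T = G.vertexSet ∧ Disjoint R S ∧ Disjoint R T ∧ Disjoint S T ∧
        -- `S` and `T` are independent and `T` is larger
        (G.IsIndependent S ∧ G.IsIndependent T ∧ S.ncard < T.ncard) ∧
        -- the cut-edges join `T` to distinct components of `G[R]`
        ((∀ e, G.IsCutEdge e → e ∈ G.edgesBetween T R) ∧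
          (∀ Q, (G.induce R).IsComponent Q → ∀ e e', G.IsCutEdge e → G.IsCutEdge e' →
            e ∈ G.edgesBetween T Q → e' ∈ G.edgesBetween T Q → e = e')) ∧
        -- the edges at `S` lead to `T`, possibly via blisters
        (∀ e, ∀ s ∈ S, ∀ x, G.IsLink e s x →
          x ∈ T ∨ ∃ Q, (G.induce R).IsComponent Q ∧ x ∈ Q ∧ G.IsBlister (2 * r + 1) S T Q) ∧
        -- the number of components of `G[R]` joined to `T` by exactly three edges
        (({Q | (G.induce R).IsComponent Q ∧ (G.edgesBetween T Q).ncard = 3}.ncard : ℤ) =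
          k * ((T.ncard : ℤ) - S.ncard) - 1) ∧
        -- the remaining components of `G[R]`
        (∀ Q, (G.induce R).IsComponent Q →
          (∀ e ∈ G.edgesBetween T Q, ¬ G.IsCutEdge e) →
          ¬ G.IsBlister (2 * r + 1) S T Q →
          (G.edgesBetween T Q).ncard ≠ 3 →
          (G.induce Q).IsRegular (2 * r + 1) ∧ ∀ e, ¬ (G.induce Q).IsCutEdge e) ∧
        -- the case of strict inequality
        (3 * k < 2 * r + 1 → (T.ncard : ℤ) - S.ncard = 1) := by
  have := hE.to_subtype
  constructor
  · intro hno
    obtain ⟨R, S, T, hP, h⟩ := G.exists_partition_of_not_hasFactor hV hk hreg hcut hno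
    exact ⟨R, S, T, hP.union_eq, hP.disjoint_RS, hP.disjoint_RT, hP.disjoint_ST, h⟩
  · rintro ⟨R, S, T, h1, h2, h3, h4, ⟨hS, hT, -⟩, -, hSedge, hthree, hrest, hstrict⟩
    exact Graph.IsPartition.not_hasFactor ⟨h1, h2, h3, h4⟩ hV hk hreg hS hT hSedge hthree
      (fun Q hQ h h' h'' ↦ (hrest Q hQ h h' h'').1) hstrict
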